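/- Let $\mathbb{C}_+=\{s:\operatorname{Re}s>0\}$, $\mathbb{R}_+=(0,\infty)$, $1<p\le 2$ and $\frac1p+\frac1{p'}=1$. For $g\in L^{p'}(\mathbb{R}_+)$ let $\mathcal{L}(g)(s)=\int_0^\infty e^{-st}g(t)\,dt$, $s\in\mathbb{C}_+$. The Hardy space $H^p(\mathbb{C}_+)$ consists of the analytic functions $\Phi$ on $\mathbb{C}_+$ with $\sup_{x>0}\left(\frac1{2\pi}\int_{-\infty}^{\infty}|\Phi(x+iy)|^p\,dy\right)^{1/p}<\infty$. For $\Phi\in H^p(\mathbb{C}_+)$, $\varphi=\mathcal{L}^{-1}(\Phi)$ means that $\varphi\in L^{p'}(\mathbb{R}_+)$ and $\mathcal{L}(\varphi)=\Phi$ on $\mathbb{C}_+$. A quotient of analytic functions on $\mathbb{C}_+$ is understood with its removable singularities removed. Let $f$ be analytic and not identically zero in a region $D\supseteq\mathbb{C}_+$, let $r$ be analytic on $\mathbb{C}_+$, and let $J\in L^{p'}(\mathbb{R}_+)$. A solution of $f(\partial_t)\phi=J$ (with generalized initial condition $r$) is a function $\phi\in L^{p'}(\mathbb{R}_+)$ such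 that $f\mathcal{L}(\phi)-r\in H^p(\mathbb{C}_+)$ and $\mathcal{L}^{-1}(f\mathcal{L}(\phi)-r)=J$. Assume that $\mathcal{L}(J)$, $(\mathcal{L}(J)+r)/f$ and $\mathcal{L}(J)/f$ belong to $H^p(\mathbb{C}_+)$. Assume that $r/f$ extends to a meromorphic function on $\mathbb{C}$ (again denoted $r/f$) whose poles in $\{\operatorname{Re}s<0\}$ are exactly the distinct points $\omega_1,\dots,\omega_N$ ($N\ge 0$), $\omega_i$ having order $r_i\ge1$, and that for some $q>0$ and some constant $C$, $|r(s)/f(s)|\le C/|s|^q$ for all sufficiently large $|s|$. Then $f(\partial_t)\phi=J$ has a solution $\phi\in L^{p'}(\mathbb{R}_+)$, unique up to equality almost everywhere, it is $\phi=\mathcal{L}^{-1}\big((\mathcal{L}(J)+r)/f\big)$, and there are polynomials $P_i$ of degree exactly $r_i-1$ such that for every $\sigma>0$ $$\phi(t)=\frac1{2\pi i}\int_{\sigma-i\infty}^{\sigma+i\infty}e^{st}\,\frac{\mathcal{L}(J)(s)}{f(s)}\,ds+\sum_{i=1}^N P_i(t)\,e^{\omega_i t}\qquad\text{for a.e. }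 t>0 .$$ Here the Bromwich integral is a function $b\in L^{p'}(\mathbb{R}_+)$, the same for all $\sigma>0$, defined as a limit in the mean: with $b_v(t)=\frac1{2\pi}\int_{-v}^{v}e^{(\sigma+i\eta)t}\,\frac{\mathcal{L}(J)(\sigma+i\eta)}{f(\sigma+i\eta)}\,d\eta$, one has $\int_0^\infty\big|e^{-\sigma t}(b_v(t)-b(t))\big|^{p'}dt\to0$ as $v\to\infty$. -/

import Mathlib

open MeasureTheory Filter Topology

/-- The open right half-plane `ℂ₊ = {s : Re s > 0}`. -/
def rightHalfPlane : Set ℂ := {s : ℂ | 0 < s.re}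

/-- Lebesgue measure on the half-line `ℝ₊ = (0, ∞)`. -/
noncomputable def halfLine : Measure ℝ := volume.restrict (Set.Ioi 0)

/-- The Laplace transform `𝓛(g)(s) = ∫₀^∞ e^{-st} g(t) dt`. For `g ∈ L^{q}(ℝ₊)`, `1 ≤ q ≤ ∞`, the
integral converges absolutely at each `s ∈ ℂ₊`. -/
noncomputable def laplace (g : ℝ → ℂ) (s : ℂ) : ℂ :=
  ∫ t, Complex.exp (-s * (t : ℂ)) * g t ∂halfLine

/-- The mean `μ_q(Φ, x) = ((2π)⁻¹ ∫ |Φ(x + iy)|^q dy)^{1/q}`, as an extended nonnegative real. -/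
noncomputable def hardyMean (q : ℝ) (Φ : ℂ → ℂ) (x : ℝ) : ENNReal :=
  (ENNReal.ofReal (1 / (2 * Real.pi)) *
    ∫⁻ y : ℝ, ‖Φ ((x : ℂ) + (y : ℂ) * Complex.I)‖ₑ ^ q) ^ (1 / q)

/-- `Φ ∈ H^q(ℂ₊)`: `Φ` is analytic on `ℂ₊` and `μ_q(Φ, x)` is uniformly bounded for `x > 0`. -/
def MemHardy (q : ℝ) (Φ : ℂ → ℂ) : Prop :=
  DifferentiableOn ℂ Φ rightHalfPlane ∧
    ∃ M : NNReal, ∀ x : ℝ, 0 < x → hardyMean q Φ x ≤ (M : ENNReal)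

/-- `F` represents the quotient `u / f` on `ℂ₊`: the two agree wherever `f` does not vanish. (For
analytic `u` and `f`, `f` not identically zero, an analytic `F` with this property is unique on
`ℂ₊`; it is `u / f` with the removable singularities removed.) -/
def IsQuotient (F u f : ℂ → ℂ) : Prop :=
  ∀ s ∈ rightHalfPlane, f s ≠ 0 → F s = u s / f s

/-- The quotient `u / f` belongs to `H^q(ℂ₊)`. -/
def QuotientMemHardy (q : ℝ) (u f : ℂ → ℂ) : Prop :=
  ∃ Φ : ℂ → ℂ, MemHardy q Φ ∧ IsQuotient Φ u f

/-- `φ = 𝓛⁻¹(Φ)` in `L^{q}(ℝ₊)`: `φ ∈ L^{q}(ℝ₊)` and `𝓛(φ) = Φ` on `ℂ₊`. (Such a `φ` is unique up to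
equality almost everywhere.) -/
def IsInverseLaplace (q : ℝ) (Φ : ℂ → ℂ) (φ : ℝ → ℂ) : Prop :=
  MemLp φ (ENNReal.ofReal q) halfLine ∧ ∀ s ∈ rightHalfPlane, laplace φ s = Φ s

/-- `φ ∈ L^{p'}(ℝ₊)` solves `f(∂ₜ) φ = J` with generalized initial condition `r`: the function
`f 𝓛(φ) - r` is in `H^p(ℂ₊)`, and `𝓛⁻¹(f 𝓛(φ) - r) = J`. -/
def IsSolution (p p' : ℝ) (f r : ℂ → ℂ) (J φ : ℝ → ℂ) : Prop :=
  MemLp φ (ENNReal.ofReal p') halfLine ∧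
    MemHardy p (fun s => f s * laplace φ s - r s) ∧
    IsInverseLaplace p' (fun s => f s * laplace φ s - r s) J

/-- The truncated Bromwich integral `(2πi)⁻¹ ∫_{σ-iv}^{σ+iv} e^{st} F(s) ds`, with `s = σ + iη` and
`ds = i dη`. -/
noncomputable def bromwichTrunc (F : ℂ → ℂ) (σ v t : ℝ) : ℂ :=
  (1 / (2 * (Real.pi : ℂ))) * ∫ η in (-v)..v,
    Complex.exp (((σ : ℂ) + (η : ℂ) * Complex.I) * (t : ℂ)) * F ((σ : ℂ) + (η : ℂ) * Complex.I)

/-- `g(t) = (2πi)⁻¹ ∫_{σ-i∞}^{σ+i∞} e^{st} F(s) ds`, where the improper integral is the limit of the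
truncated integrals in the mean of order `q` on `ℝ₊`, with the weight `e^{-σt}`:
`∫₀^∞ |e^{-σt} (g_v(t) - g(t))|^q dt → 0` as `v → ∞`. -/
def IsBromwichIntegral (q : ℝ) (F : ℂ → ℂ) (σ : ℝ) (g : ℝ → ℂ) : Prop :=
  Tendsto (fun v : ℝ => eLpNorm
      (fun t : ℝ => Complex.exp (-((σ : ℂ) * (t : ℂ))) * (bromwichTrunc F σ v t - g t))
      (ENNReal.ofReal q) halfLine)
    atTop (𝓝 0)

/-! Write `Φ` for `(𝓛 J + r)/f` and `F` for `𝓛 J / f`, both in `H^p(ℂ₊)`. Wherever `f ≠ 0` their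
difference is `r/f`, so the theorem splits into inverting `F` by a Bromwich integral and inverting
`r/f` explicitly.

Inversion in `H^p` is `MemHardy.exists_isInverseLaplace`. On the line `Re s = σ`, the
Hausdorff-Young inequality (`exists_eLpNorm_fourier_le`, by real interpolation between `L¹ → L^∞`
and Plancherel) makes the truncated Bromwich integrals Cauchy in a weighted `L^{p'}`. Cauchy's
formula on the half-plane (`integral_mul_cauchyKernel`) shows that the limit has Laplace transform
`F`. Injectivity of the Laplace transform identifies the limits for different `σ`, and bounds
uniform in `σ` put the common function in unweighted `L^{p'}` as `σ → 0`.

For `r/f`, no pole can lie in `ℂ₊`, where it agrees with the analytic function `Φ - F` off isolated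
points, nor on the imaginary axis, where a pole would make the `L^p` means blow up because `p > 1`
(`meromorphicOrderAt_nonneg_of_re_eq_zero`). Only the `ω i` remain, and by Liouville and the decay
at infinity `r/f` is the sum of its principal parts (`exists_partialFractions`). A principal part of
order `m` is the transform of `P(t) e^{ωt}` with `deg P = m - 1`.

The sum of the two preimages has transform `Φ`, hence solves the equation. Uniqueness follows
because the zeros of `f` are isolated and the Laplace transform is injective. -/

/-! ### The Hausdorff-Young inequality on the line. -/

open FourierTransform SchwartzMap ContDiff in
/-- Plancherel's identity for the Fourier integral of an integrable, square integrable function. -/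
theorem eLpNorm_fourier_two {g : ℝ → ℂ} (hg : Integrable g) (hg2 : MemLp g 2) :
    eLpNorm (𝓕 g) 2 = eLpNorm g 2 := by
  set u : Lp (α := ℝ) ℂ 2 volume := 𝓕 (hg2.toLp g) with hu
  -- The `L²` Fourier transform `u` is identified with the Fourier integral by duality: against a
  -- Schwartz function both give `∫ (𝓕 φ) g`. The isometry of the `L²` transform then applies to `𝓕
  -- g`.
  have key : ∀ φ : 𝓢(ℝ, ℂ), ∫ x, φ x • u x = ∫ x, φ x • 𝓕 g x := by
    intro φ
    have h1 : Lp.toTemperedDistribution u φ = Lp.toTemperedDistribution (hg2.toLp g) (𝓕 φ) := by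
      rw [hu, ← Lp.fourier_toTemperedDistribution_eq]
      rfl
    rw [Lp.toTemperedDistribution_apply, Lp.toTemperedDistribution_apply] at h1
    rw [h1]
    have h2 : ∫ x, (𝓕 φ) x • (hg2.toLp g) x = ∫ x, (𝓕 φ) x • g x := by
      refine integral_congr_ae ?_
      filter_upwards [hg2.coeFn_toLp] with x hx
      rw [hx]
    rw [h2, SchwartzMap.fourier_coe]
    have := VectorFourier.integral_fourierIntegral_smul_eq_flip (L := innerₗ ℝ) (μ := volume)
      (ν := volume) Real.continuous_fourierChar continuous_inner φ.integrable hg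
    rw [flip_innerₗ] at this
    exact this
  have hcont : Continuous (𝓕 g) := VectorFourier.fourierIntegral_continuous
      Real.continuous_fourierChar continuous_inner hg
  have hae : (u : ℝ → ℂ) =ᵐ[volume] 𝓕 g := by
    refine ae_eq_of_integral_contDiff_smul_eq ((Lp.memLp u).locallyIntegrable (by norm_num))
      hcont.locallyIntegrable ?_
    intro φ hφ hc
    have hc' : HasCompactSupport (fun x => (φ x : ℂ)) := hc.comp_left Complex.ofReal_zero
    have hφ' : ContDiff ℝ ∞ (fun x => (φ x : ℂ)) := Complex.ofRealCLM.contDiff.comp hφ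
    have := key (hc'.toSchwartzMap hφ')
    simpa using this
  rw [← eLpNorm_congr_ae hae, ← Lp.enorm_def, hu, ← eLpNorm_congr_ae hg2.coeFn_toLp, ← Lp.enorm_def]
  have := Lp.norm_fourier_eq (hg2.toLp g)
  rw [← ofReal_norm, ← ofReal_norm, this]

open FourierTransform in
/-- The bound for the distribution function of the Fourier integral used in real interpolation. -/
theorem meas_norm_fourier_ge_le {p A : ℝ} (hp1 : 1 < p) (hA : 0 < A) {g : ℝ → ℂ}
    (hgm : Measurable g) (hg : Integrable g) (hgA : ∫⁻ x, ENNReal.ofReal (‖g x‖ ^ p) = ENNReal.ofReal A)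
    {t : ℝ} (ht : 0 < t) :
    volume {y : ℝ | t ≤ ‖𝓕 g y‖} ≤ ENNReal.ofReal (4 / t ^ 2) *
      ∫⁻ x, {x | t * ‖g x‖ ^ (p - 1) ≤ 2 * A}.indicator (fun x => ENNReal.ofReal (‖g x‖ ^ 2)) x := by
  -- Marcinkiewicz splitting at a height depending on `t`. Off `S`, `|g| ≤ (t / 2A) |g|^p`, so the
  -- large part `g1` has `L¹` norm at most `t/2` and `|𝓕 g1| ≤ t/2`. Hence `|𝓕 g| ≥ t` forces `|𝓕
  -- g2| ≥ t/2` for the bounded part, to which Chebyshev and Plancherel apply; `4 / t²` is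
  -- `(t/2)⁻²`.
  set S := {x | t * ‖g x‖ ^ (p - 1) ≤ 2 * A} with hS
  have hSm : MeasurableSet S := by
    refine measurableSet_le ?_ measurable_const
    exact (hgm.norm.pow_const _).const_mul _
  set g2 := S.indicator g with hg2
  set g1 := Sᶜ.indicator g with hg1
  have hg1i : Integrable g1 := hg.indicator hSm.compl
  have hg2i : Integrable g2 := hg.indicator hSm
  have hsum : g = g1 + g2 := (Set.indicator_compl_add_self S g).symm
  have hF : 𝓕 g = 𝓕 g1 + 𝓕 g2 := by
    conv_lhs => rw [hsum]
    exact VectorFourier.fourierIntegral_add Real.continuous_fourierChar continuous_inner hg1i hg2i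
  have hb1 : ∀ y, ‖𝓕 g1 y‖ ≤ t / 2 := by
    intro y
    refine (VectorFourier.norm_fourierIntegral_le_integral_norm _ _ _ _ _).trans ?_
    rw [integral_norm_eq_lintegral_enorm hg1i.aestronglyMeasurable]
    refine ENNReal.toReal_le_of_le_ofReal (by positivity) ?_
    calc ∫⁻ x, ‖g1 x‖ₑ ≤ ∫⁻ x, ENNReal.ofReal (t / (2 * A)) * ENNReal.ofReal (‖g x‖ ^ p) := by
          refine lintegral_mono fun x => ?_
          by_cases hx : x ∈ S
          · simp [hg1, hx]
          · have hx' : 2 * A < t * ‖g x‖ ^ (p - 1) := not_le.1 hx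
            rw [hg1, Set.indicator_of_mem (by exact hx), ← ENNReal.ofReal_mul (by positivity),
              ← ofReal_norm]
            refine ENNReal.ofReal_le_ofReal ?_
            have hn : 0 < ‖g x‖ := by
              rcases (norm_nonneg (g x)).eq_or_lt with h | h
              · rw [← h, Real.zero_rpow (by linarith)] at hx'; linarith
              · exact h
            have : ‖g x‖ ^ p = ‖g x‖ ^ (p - 1) * ‖g x‖ := by
              rw [← Real.rpow_add_one hn.ne']; ring_nf
            rw [this, div_mul_eq_mul_div, le_div_iff₀ (by positivity)]
            nlinarith
      _ = ENNReal.ofReal (t / 2) := by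
          rw [lintegral_const_mul _ (by fun_prop), hgA, ← ENNReal.ofReal_mul (by positivity)]
          congr 1; field_simp
  have hbd : ∀ x, ‖g2 x‖ ≤ (2 * A / t) ^ (1 / (p - 1)) := by
    intro x
    by_cases hx : x ∈ S
    · have hx' : t * ‖g x‖ ^ (p - 1) ≤ 2 * A := hx
      rw [hg2, Set.indicator_of_mem hx]
      have h1 : ‖g x‖ = (‖g x‖ ^ (p - 1)) ^ (1 / (p - 1)) := by
        rw [← Real.rpow_mul (norm_nonneg _), mul_one_div_cancel (by linarith), Real.rpow_one]
      rw [h1]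
      refine Real.rpow_le_rpow (by positivity) ?_ (by have : 0 < p - 1 := by linarith
                                                      positivity)
      rw [le_div_iff₀ ht]; linarith
    · simp only [hg2, Set.indicator_of_notMem hx, norm_zero]; positivity
  have hg2L : MemLp g2 2 := by
    rw [memLp_two_iff_integrable_sq_norm hg2i.aestronglyMeasurable]
    refine (hg2i.norm.const_mul ((2 * A / t) ^ (1 / (p - 1)))).mono' (by fun_prop)
      (ae_of_all _ fun x => ?_)
    rw [Real.norm_of_nonneg (by positivity), sq]
    exact mul_le_mul_of_nonneg_right (hbd x) (norm_nonneg _)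
  have hpl : ∫⁻ y, ‖𝓕 g2 y‖ₑ ^ (2 : ℝ) = ∫⁻ x, ‖g2 x‖ₑ ^ (2 : ℝ) := by
    have := eLpNorm_fourier_two hg2i hg2L
    rw [eLpNorm_eq_lintegral_rpow_enorm_toReal (by norm_num) (by norm_num),
      eLpNorm_eq_lintegral_rpow_enorm_toReal (by norm_num) (by norm_num)] at this
    exact ENNReal.rpow_left_injective (x := (2 : ℝ)⁻¹) (by norm_num) (by simpa using this)
  have hcont : Continuous (𝓕 g2) := VectorFourier.fourierIntegral_continuous
      Real.continuous_fourierChar continuous_inner hg2i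
  have hsub : {y : ℝ | t ≤ ‖𝓕 g y‖} ⊆ {y | ENNReal.ofReal (t / 2) ^ (2 : ℝ) ≤ ‖𝓕 g2 y‖ₑ ^ (2 : ℝ)} := by
    intro y hy
    have hy' : t ≤ ‖𝓕 g y‖ := hy
    rw [hF, Pi.add_apply] at hy'
    have := norm_add_le (𝓕 g1 y) (𝓕 g2 y)
    have h3 := hb1 y
    refine ENNReal.rpow_le_rpow ?_ (by norm_num)
    rw [← ofReal_norm]
    exact ENNReal.ofReal_le_ofReal (by linarith)
  have hmk := mul_meas_ge_le_lintegral₀ (μ := volume) (f := fun y => ‖𝓕 g2 y‖ₑ ^ (2 : ℝ))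
    (by fun_prop) (ENNReal.ofReal (t / 2) ^ (2 : ℝ))
  rw [hpl] at hmk
  have hc : ENNReal.ofReal (4 / t ^ 2) * ENNReal.ofReal (t / 2) ^ (2 : ℝ) = 1 := by
    rw [ENNReal.ofReal_rpow_of_pos (by positivity), ← ENNReal.ofReal_mul (by positivity),
      ← ENNReal.ofReal_one]
    congr 1
    rw [Real.rpow_two]; field_simp
    norm_num
  have hint : ∫⁻ x, ‖g2 x‖ₑ ^ (2 : ℝ)
      = ∫⁻ x, S.indicator (fun x => ENNReal.ofReal (‖g x‖ ^ 2)) x := by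
    refine lintegral_congr fun x => ?_
    by_cases hx : x ∈ S
    · simp only [hg2, Set.indicator_of_mem hx]
      rw [← ofReal_norm, ENNReal.ofReal_pow (norm_nonneg _)]
      norm_num
    · simp [hg2, hx]
  rw [← hint]
  calc volume {y : ℝ | t ≤ ‖𝓕 g y‖} ≤ _ := measure_mono hsub
    _ = ENNReal.ofReal (4 / t ^ 2) * (ENNReal.ofReal (t / 2) ^ (2 : ℝ) *
        volume {y | ENNReal.ofReal (t / 2) ^ (2 : ℝ) ≤ ‖𝓕 g2 y‖ₑ ^ (2 : ℝ)}) := by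
        rw [← mul_assoc, hc, one_mul]
    _ ≤ _ := by gcongr

open FourierTransform in
/-- The strong-type bound behind the Hausdorff-Young inequality, obtained by real interpolation. -/
theorem lintegral_norm_fourier_rpow_le {p p' A : ℝ} (hp1 : 1 < p) (hpp : p.HolderConjugate p')
    (hp2 : 2 < p') (hA : 0 < A) {g : ℝ → ℂ} (hgm : Measurable g) (hg : Integrable g)
    (hgA : ∫⁻ x, ENNReal.ofReal (‖g x‖ ^ p) = ENNReal.ofReal A) :
    ∫⁻ y, ENNReal.ofReal (‖𝓕 g y‖ ^ p') ≤
      ENNReal.ofReal (4 * p' * 2 ^ (p' - 2) / (p' - 2) * A ^ (p' - 1)) := by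
  have hcont : Continuous (𝓕 g) := VectorFourier.fourierIntegral_continuous
      Real.continuous_fourierChar continuous_inner hg
  have hpe : (p - 1) * (p' - 2) = 2 - p := by
    have := hpp.sub_one_mul_conj
    nlinarith
  -- Layer-cake formula. After the distribution bound is inserted and the integrals are swapped, the
  -- `t`-integral of `4 t^(p'-3)` stops at `2A / |g|^(p-1)`; it converges at `0` because `p' > 2`,
  -- and `hpe` turns the resulting power of `|g|` into `|g|^p`.
  rw [lintegral_rpow_eq_lintegral_meas_le_mul volume (ae_of_all _ fun _ => norm_nonneg _)
    hcont.norm.aemeasurable (by linarith)]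
  set K : ℝ → ℝ → ENNReal := fun t x => {q : ℝ × ℝ | q.1 * ‖g q.2‖ ^ (p - 1) ≤ 2 * A}.indicator
    (fun q => ENNReal.ofReal (4 * q.1 ^ (p' - 3)) * ENNReal.ofReal (‖g q.2‖ ^ 2)) (t, x) with hK
  have hKm : Measurable (Function.uncurry K) := by
    have : Function.uncurry K = {q : ℝ × ℝ | q.1 * ‖g q.2‖ ^ (p - 1) ≤ 2 * A}.indicator
        (fun q => ENNReal.ofReal (4 * q.1 ^ (p' - 3)) * ENNReal.ofReal (‖g q.2‖ ^ 2)) := by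
      ext ⟨t, x⟩; rfl
    rw [this]
    refine Measurable.indicator (by fun_prop) (measurableSet_le (by fun_prop) measurable_const)
  have h1 : ∫⁻ t in Set.Ioi (0 : ℝ), volume {y : ℝ | t ≤ ‖𝓕 g y‖} * ENNReal.ofReal (t ^ (p' - 1)) ≤
      ∫⁻ t in Set.Ioi (0 : ℝ), ∫⁻ x, K t x := by
    refine setLIntegral_mono' measurableSet_Ioi fun t ht => ?_
    have ht : 0 < t := ht
    refine (mul_le_mul_left (meas_norm_fourier_ge_le hp1 hA hgm hg hgA ht) _).trans (le_of_eq ?_)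
    rw [mul_right_comm, ← ENNReal.ofReal_mul (by positivity), ← lintegral_const_mul' _ _ (by simp)]
    refine lintegral_congr fun x => ?_
    have ht3 : 4 / t ^ 2 * t ^ (p' - 1) = 4 * t ^ (p' - 3) := by
      have : t ^ (p' - 1) = t ^ (p' - 3) * t ^ 2 := by
        rw [← Real.rpow_natCast, ← Real.rpow_add ht]; congr 1; push_cast; ring
      rw [this]; field_simp
    by_cases hx : t * ‖g x‖ ^ (p - 1) ≤ 2 * A
    · simp only [hK]
      rw [Set.indicator_of_mem (by exact hx), Set.indicator_of_mem (by exact hx), ht3]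
    · simp only [hK]
      rw [Set.indicator_of_notMem (by exact hx), Set.indicator_of_notMem (by exact hx), mul_zero]
  have h2 : ∀ x, ∫⁻ t in Set.Ioi (0 : ℝ), K t x ≤
      ENNReal.ofReal (4 * (2 * A) ^ (p' - 2) / (p' - 2)) * ENNReal.ofReal (‖g x‖ ^ p) := by
    intro x
    rcases (norm_nonneg (g x)).eq_or_lt with h0 | h0
    · have : ∀ t, K t x = 0 := by
        intro t
        refine Set.indicator_apply_eq_zero.2 fun _ => ?_
        simp [← h0]
      simp [this]
    set c := ‖g x‖ ^ (p - 1) with hc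
    have hc0 : 0 < c := by positivity
    have hi : IntervalIntegrable (fun t : ℝ => 4 * t ^ (p' - 3)) volume 0 (2 * A / c) :=
      (intervalIntegral.intervalIntegrable_rpow' (by linarith)).const_mul _
    calc ∫⁻ t in Set.Ioi (0 : ℝ), K t x
        ≤ ∫⁻ t in Set.Ioi (0 : ℝ), (Set.Ioc 0 (2 * A / c)).indicator (fun t =>
            ENNReal.ofReal (4 * t ^ (p' - 3)) * ENNReal.ofReal (‖g x‖ ^ 2)) t := by
          refine setLIntegral_mono' measurableSet_Ioi fun t ht => ?_
          by_cases hx : t * ‖g x‖ ^ (p - 1) ≤ 2 * A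
          · rw [Set.indicator_of_mem (show t ∈ Set.Ioc 0 (2 * A / c) from ⟨ht, (le_div_iff₀ hc0).2 hx⟩)]
            simp only [hK]
            rw [Set.indicator_of_mem (by exact hx)]
          · simp only [hK]
            rw [Set.indicator_of_notMem (by exact hx)]
            exact zero_le
      _ ≤ ∫⁻ t in Set.Ioc (0 : ℝ) (2 * A / c),
            ENNReal.ofReal (4 * t ^ (p' - 3)) * ENNReal.ofReal (‖g x‖ ^ 2) := by
          rw [← lintegral_indicator measurableSet_Ioc]
          exact setLIntegral_le_lintegral _ _
      _ = ENNReal.ofReal (4 * ((2 * A / c) ^ (p' - 2) / (p' - 2))) * ENNReal.ofReal (‖g x‖ ^ 2) := by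
          rw [lintegral_mul_const' _ _ (by simp), ← ofReal_integral_eq_lintegral_ofReal]
          · rw [← intervalIntegral.integral_of_le (by positivity), intervalIntegral.integral_const_mul,
              integral_rpow (Or.inl (by linarith)), Real.zero_rpow (by linarith)]
            congr 4
            · ring_nf
            · ring
          · exact (intervalIntegrable_iff_integrableOn_Ioc_of_le (by positivity)).1 hi
          · filter_upwards [self_mem_ae_restrict measurableSet_Ioc] with t ht
            have : 0 < t := ht.1
            positivity
      _ = _ := by
          rw [← ENNReal.ofReal_mul (by have : 0 < p' - 2 := by linarith
                                       positivity),
            ← ENNReal.ofReal_mul (by have : 0 < p' - 2 := by linarith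
                                     positivity)]
          congr 1
          have h5 : ‖g x‖ ^ 2 = c ^ (p' - 2) * ‖g x‖ ^ p := by
            rw [hc, ← Real.rpow_mul h0.le, ← Real.rpow_add h0, hpe, ← Real.rpow_natCast]
            congr 1; push_cast; ring
          rw [h5, Real.div_rpow (by positivity) hc0.le]
          have : 0 < c ^ (p' - 2) := by positivity
          field_simp
  calc _ ≤ ENNReal.ofReal p' * ∫⁻ x, ∫⁻ t in Set.Ioi (0 : ℝ), K t x := by
        rw [lintegral_lintegral_swap (by exact (hKm.comp measurable_swap).aemeasurable)]
        exact mul_le_mul_right h1 _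
    _ ≤ ENNReal.ofReal p' * (ENNReal.ofReal (4 * (2 * A) ^ (p' - 2) / (p' - 2)) *
          ENNReal.ofReal A) := by
        refine mul_le_mul_right ?_ _
        rw [← hgA, ← lintegral_const_mul' _ _ (by simp)]
        exact lintegral_mono h2
    _ = _ := by
        have : 0 < p' - 2 := by linarith
        rw [← ENNReal.ofReal_mul (by positivity), ← ENNReal.ofReal_mul (by linarith)]
        congr 1
        have h6 : A ^ (p' - 1) = A ^ (p' - 2) * A := by
          rw [← Real.rpow_add_one hA.ne']; ring_nf
        rw [h6, Real.mul_rpow (by norm_num) hA.le]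
        ring

open FourierTransform in
/-- The Hausdorff-Young inequality on the line, with an unspecified constant. -/
theorem exists_eLpNorm_fourier_le {p p' : ℝ} (hp1 : 1 < p) (hp2 : p ≤ 2)
    (hpp : p.HolderConjugate p') :
    ∃ C : NNReal, ∀ g : ℝ → ℂ, Measurable g → Integrable g → MemLp g (ENNReal.ofReal p) →
      eLpNorm (𝓕 g) (ENNReal.ofReal p') ≤ C * eLpNorm g (ENNReal.ofReal p) := by
  -- The interpolation constant contains `1/(p' - 2)`, so `p = 2` is treated separately, by
  -- Plancherel.
  rcases hp2.eq_or_lt with rfl | hp2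
  · have : p' = 2 := by
      have := hpp.sub_one_mul_conj
      linarith
    subst this
    refine ⟨1, fun g hgm hg hgp => ?_⟩
    have h2 : ENNReal.ofReal 2 = 2 := by norm_num
    rw [h2] at hgp ⊢
    rw [eLpNorm_fourier_two hg hgp, ENNReal.coe_one, one_mul]
  have hp' : 2 < p' := by
    have := hpp.sub_one_mul_conj
    have := hpp.symm.pos
    nlinarith
  set c : ℝ := 4 * p' * 2 ^ (p' - 2) / (p' - 2) with hc
  have hc0 : 0 ≤ c := by
    have : 0 < p' - 2 := by linarith
    positivity
  refine ⟨(c ^ (1 / p')).toNNReal, fun g hgm hg hgp => ?_⟩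
  have hpne : ENNReal.ofReal p ≠ 0 := by simp; linarith
  have hpne' : ENNReal.ofReal p' ≠ 0 := by simp; linarith
  rcases eq_or_ne (eLpNorm g (ENNReal.ofReal p)) 0 with h0 | h0
  · rw [eLpNorm_eq_zero_iff hg.aestronglyMeasurable hpne] at h0
    have : 𝓕 g = 0 := by
      ext y
      rw [Real.fourier_congr_ae h0, Real.fourier_eq]
      simp
    rw [this]
    simp
  set A := (∫⁻ x, ENNReal.ofReal (‖g x‖ ^ p)).toReal with hA
  have hAe : ∀ h : ℝ → ℂ, ∀ q : ℝ, 0 < q → eLpNorm h (ENNReal.ofReal q) =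
      (∫⁻ x, ENNReal.ofReal (‖h x‖ ^ q)) ^ (1 / q) := by
    intro h q hq
    rw [eLpNorm_eq_lintegral_rpow_enorm_toReal (by simpa using hq) (by simp),
      ENNReal.toReal_ofReal hq.le]
    congr 1
    refine lintegral_congr fun x => ?_
    rw [← ofReal_norm, ENNReal.ofReal_rpow_of_nonneg (norm_nonneg _) hq.le]
  have hfin : (∫⁻ x, ENNReal.ofReal (‖g x‖ ^ p)) ≠ ⊤ := by
    intro h
    have := hgp.2
    rw [hAe g p (by linarith), h, ENNReal.top_rpow_of_pos (by positivity)] at this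
    exact lt_irrefl _ this
  have hA0 : 0 < A := by
    refine ENNReal.toReal_pos (fun h => h0 ?_) hfin
    rw [hAe g p (by linarith), h, ENNReal.zero_rpow_of_pos (by positivity)]
  have hgA : ∫⁻ x, ENNReal.ofReal (‖g x‖ ^ p) = ENNReal.ofReal A := (ENNReal.ofReal_toReal hfin).symm
  have := lintegral_norm_fourier_rpow_le hp1 hpp hp' hA0 hgm hg hgA
  rw [hAe _ p' (by linarith), hAe _ p (by linarith), hgA]
  refine (ENNReal.rpow_le_rpow this (by positivity)).trans (le_of_eq ?_)
  rw [← hc, ENNReal.ofReal_rpow_of_nonneg (by positivity) (by positivity),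
    ENNReal.ofReal_rpow_of_nonneg (by positivity) (by positivity), 
    Real.mul_rpow hc0 (by positivity), ENNReal.ofReal_mul (by positivity), ← Real.rpow_mul hA0.le]
  have : (p' - 1) * (1 / p') = 1 / p := by
    have h := hpp.symm.one_sub_inv
    have : p' ≠ 0 := by linarith
    rw [one_div p, ← h]; field_simp
  rw [this]; rfl

/-! ### Injectivity of the Laplace transform on a vertical line. -/

open FourierTransform SchwartzMap ContDiff in
/-- An integrable function whose Fourier integral vanishes almost everywhere is zero. -/
theorem ae_eq_zero_of_fourier_ae_eq_zero {g : ℝ → ℂ} (hg : Integrable g)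
    (h : ∀ᵐ w, 𝓕 g w = 0) : g =ᵐ[volume] 0 := by
  refine ae_eq_zero_of_integral_contDiff_smul_eq_zero hg.locallyIntegrable ?_
  intro φ hφ hc
  have hc' : HasCompactSupport (fun x => (φ x : ℂ)) := hc.comp_left Complex.ofReal_zero
  have hφ' : ContDiff ℝ ∞ (fun x => (φ x : ℂ)) := Complex.ofRealCLM.contDiff.comp hφ
  -- Each test function is the Fourier transform of a Schwartz function `ψ`, so pairing it with `g`
  -- equals pairing `ψ` with `𝓕 g = 0`.
  set ψ : 𝓢(ℝ, ℂ) := 𝓕⁻ (hc'.toSchwartzMap hφ') with hψ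
  have h1 : ∀ x, (φ x : ℂ) = 𝓕 (ψ : ℝ → ℂ) x := by
    intro x
    rw [← SchwartzMap.fourier_coe, hψ, FourierTransform.fourier_fourierInv_eq]
    simp
  have h2 := VectorFourier.integral_fourierIntegral_smul_eq_flip (L := innerₗ ℝ) (μ := volume)
      (ν := volume) Real.continuous_fourierChar continuous_inner ψ.integrable hg
  rw [flip_innerₗ] at h2
  calc ∫ x, φ x • g x = ∫ x, 𝓕 (ψ : ℝ → ℂ) x • g x := by
        refine integral_congr_ae (ae_of_all _ fun x => ?_)
        simp [← h1]
    _ = ∫ x, ψ x • 𝓕 g x := h2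
    _ = 0 := by
        rw [← integral_zero ℝ ℂ]
        refine integral_congr_ae ?_
        filter_upwards [h] with x hx
        simp [hx]

open FourierTransform in
/-- On a vertical line the Laplace transform is a Fourier integral. -/
theorem laplace_eq_fourier (ψ : ℝ → ℂ) (c w : ℝ) :
    laplace ψ ((c : ℂ) + ((2 * Real.pi * w : ℝ) : ℂ) * Complex.I) =
      𝓕 ((Set.Ioi (0 : ℝ)).indicator fun t => Complex.exp (-(c : ℂ) * t) * ψ t) w := by
  rw [Real.fourier_real_eq_integral_exp_smul, laplace, halfLine,
    ← integral_indicator measurableSet_Ioi]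
  refine integral_congr_ae (ae_of_all _ fun t => ?_)
  by_cases ht : t ∈ Set.Ioi (0 : ℝ)
  · simp only [Set.indicator_of_mem ht, smul_eq_mul]
    rw [← mul_assoc, ← Complex.exp_add]
    congr 2
    push_cast
    ring
  · simp only [Set.indicator_of_notMem ht, smul_zero]

/-- Uniqueness for the Laplace transform on a single vertical line. -/
theorem ae_eq_of_laplace_ae_eq {ψ χ : ℝ → ℂ} {c : ℝ}
    (hψ : Integrable (fun t : ℝ => Complex.exp (-(c : ℂ) * t) * ψ t) halfLine)
    (hχ : Integrable (fun t : ℝ => Complex.exp (-(c : ℂ) * t) * χ t) halfLine)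
    (h : ∀ᵐ η : ℝ, laplace ψ ((c : ℂ) + (η : ℂ) * Complex.I) =
      laplace χ ((c : ℂ) + (η : ℂ) * Complex.I)) :
    ψ =ᵐ[halfLine] χ := by
  have hψ' := (integrable_indicator_iff measurableSet_Ioi).2 hψ
  have hχ' := (integrable_indicator_iff measurableSet_Ioi).2 hχ
  have hq : ∀ᵐ w : ℝ, laplace ψ ((c : ℂ) + ((2 * Real.pi * w : ℝ) : ℂ) * Complex.I) =
      laplace χ ((c : ℂ) + ((2 * Real.pi * w : ℝ) : ℂ) * Complex.I) := by
    rw [ae_iff] at h ⊢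
    have := Real.volume_preimage_mul_left (a := 2 * Real.pi) (by positivity)
      {η : ℝ | ¬ laplace ψ ((c : ℂ) + (η : ℂ) * Complex.I) =
      laplace χ ((c : ℂ) + (η : ℂ) * Complex.I)}
    rw [h, mul_zero] at this
    exact this
  have h0 := ae_eq_zero_of_fourier_ae_eq_zero (hψ'.sub hχ') (by
    filter_upwards [hq] with w hw
    rw [laplace_eq_fourier, laplace_eq_fourier] at hw
    have h1 := congrFun (VectorFourier.fourierIntegral_add (L := innerₗ ℝ) (μ := volume)
      Real.continuous_fourierChar continuous_inner (hψ'.sub hχ') hχ') w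
    rw [sub_add_cancel, Pi.add_apply] at h1
    exact add_eq_right.1 (h1.symm.trans hw))
  rw [halfLine, Filter.EventuallyEq, ae_restrict_iff' measurableSet_Ioi]
  filter_upwards [h0] with t ht hmem
  rw [Pi.sub_apply, Set.indicator_of_mem hmem, Set.indicator_of_mem hmem, ← mul_sub] at ht
  have := (mul_eq_zero.1 ht).resolve_left (Complex.exp_ne_zero _)
  exact sub_eq_zero.1 this

/-! ### Exponential polynomials and their Laplace transforms. -/

theorem measurable_cexp_mul (s : ℂ) : Measurable fun t : ℝ => Complex.exp (s * t) := by
  fun_prop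

/-- Exponential polynomials with negative exponent are in every `L^q(ℝ₊)`. -/
theorem memLp_pow_mul_exp {q : ℝ} (hq : 0 < q) (k : ℕ) {s : ℂ} (hs : s.re < 0) :
    MemLp (fun t : ℝ => (t : ℂ) ^ k * Complex.exp (s * t)) (ENNReal.ofReal q) halfLine := by
  rw [← integrable_norm_rpow_iff (by fun_prop) (by simpa using hq) (by simp),
    ENNReal.toReal_ofReal hq.le]
  have := integrableOn_rpow_mul_exp_neg_mul_rpow (s := k * q) (p := 1) (b := -s.re * q)
    (by have : 0 ≤ k * q := by positivity
        linarith) one_pos (by nlinarith)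
  refine this.congr_fun (fun t ht => ?_) measurableSet_Ioi
  have ht : 0 < t := ht
  simp only [norm_mul, norm_pow, Complex.norm_exp, Complex.norm_real, Real.norm_of_nonneg ht.le,
    Real.rpow_one]
  rw [Real.mul_rpow (by positivity) (by positivity), ← Real.exp_mul, ← Real.rpow_natCast,
    ← Real.rpow_mul ht.le]
  congr 2
  simp
  ring

theorem memLp_exp {q : ℝ} (hq : 0 < q) {s : ℂ} (hs : 0 < s.re) :
    MemLp (fun t : ℝ => Complex.exp (-s * t)) (ENNReal.ofReal q) halfLine := by
  simpa using memLp_pow_mul_exp hq 0 (s := -s) (by simpa using hs)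

/-- The Laplace integral of an `L^{p'}` function converges absolutely on the right half-plane. -/
theorem integrable_exp_mul {p p' : ℝ} (hpp : p.HolderConjugate p') {g : ℝ → ℂ}
    (hg : MemLp g (ENNReal.ofReal p') halfLine) {s : ℂ} (hs : 0 < s.re) :
    Integrable (fun t : ℝ => Complex.exp (-s * t) * g t) halfLine := by
  have : ENNReal.HolderConjugate (ENNReal.ofReal p) (ENNReal.ofReal p') :=
    ⟨by rw [hpp.inv_add_inv_ennreal, inv_one]⟩
  exact (memLp_exp hpp.pos hs).integrable_mul hg

theorem integrable_pow_mul_exp (k : ℕ) {s : ℂ} (hs : s.re < 0) :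
    Integrable (fun t : ℝ => (t : ℂ) ^ k * Complex.exp (s * t)) halfLine := by
  simpa [memLp_one_iff_integrable] using memLp_pow_mul_exp one_pos k hs

/-- Induction on `k`: the derivative of `t^(k+1) e^{st}` has integral zero, since this function
vanishes at `0` and at infinity, and that relates consecutive moments. -/
theorem integral_pow_mul_exp (k : ℕ) {s : ℂ} (hs : s.re < 0) :
    ∫ t : ℝ, (t : ℂ) ^ k * Complex.exp (s * t) ∂halfLine = k.factorial / (-s) ^ (k + 1) := by
  have hs0 : s ≠ 0 := fun h => by simp [h] at hs
  induction k with
  | zero =>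
    have := integral_exp_mul_complex_Ioi hs 0
    simpa [halfLine, div_neg, neg_div] using this
  | succ k ih =>
    have hd : ∀ t : ℝ, HasDerivAt (fun t : ℝ => (t : ℂ) ^ (k + 1) * Complex.exp (s * t))
        ((k + 1) * ((t : ℂ) ^ k * Complex.exp (s * t)) +
          s * ((t : ℂ) ^ (k + 1) * Complex.exp (s * t))) t := by
      intro t
      have h1 : HasDerivAt (fun z : ℂ => z ^ (k + 1) * Complex.exp (s * z))
          (((k + 1 : ℕ) * (t : ℂ) ^ k * 1) * Complex.exp (s * t) +
            (t : ℂ) ^ (k + 1) * (Complex.exp (s * t) * (s * 1))) (t : ℂ) :=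
        ((hasDerivAt_id (t : ℂ)).pow (k + 1)).mul ((hasDerivAt_id (t : ℂ)).const_mul s).cexp
      convert! h1.comp_ofReal using 1
      push_cast
      ring
    have hi1 := (integrable_pow_mul_exp k hs).const_mul ((k : ℂ) + 1)
    have hi2 := (integrable_pow_mul_exp (k + 1) hs).const_mul s
    have hz := tendsto_zero_of_hasDerivAt_of_integrableOn_Ioi (a := 0) (fun t _ => hd t)
      (hi1.add hi2) (integrable_pow_mul_exp (k + 1) hs)
    have hf := integral_Ioi_of_hasDerivAt_of_tendsto (a := 0) (hd 0).continuousAt.continuousWithinAt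
      (fun t _ => hd t) (hi1.add hi2) hz
    have hf' : ∫ t : ℝ, ((k : ℂ) + 1) * ((t : ℂ) ^ k * Complex.exp (s * t)) +
          s * ((t : ℂ) ^ (k + 1) * Complex.exp (s * t)) ∂halfLine = 0 := by
      simpa [halfLine] using hf
    rw [integral_add hi1 hi2, integral_const_mul, integral_const_mul, ih] at hf'
    have h3 : (-s) * ∫ t : ℝ, (t : ℂ) ^ (k + 1) * Complex.exp (s * t) ∂halfLine =
        (k + 1) * (k.factorial / (-s) ^ (k + 1)) := by linear_combination -hf'
    have hs1 : -s ≠ 0 := neg_ne_zero.2 hs0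
    rw [eq_div_iff (pow_ne_zero _ hs1), pow_succ, Nat.factorial_succ, mul_comm ((-s) ^ (k + 1)),
      ← mul_assoc, mul_comm _ (-s), h3]
    push_cast
    field_simp

theorem laplace_pow_mul_exp (k : ℕ) {ω s : ℂ} (hs : ω.re < s.re) :
    laplace (fun t : ℝ => (t : ℂ) ^ k * Complex.exp (ω * t)) s = k.factorial / (s - ω) ^ (k + 1) := by
  have := integral_pow_mul_exp k (s := ω - s) (by simpa using hs)
  rw [neg_sub] at this
  rw [← this, laplace]
  refine integral_congr_ae (ae_of_all _ fun t => ?_)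
  simp only
  rw [mul_left_comm, ← Complex.exp_add]
  congr 2
  ring

/-! ### Cauchy's formula for Hardy functions on a half-plane. -/

/-- Uniform `L^q` bounds on vertical lines for a function in the Hardy space. -/
theorem MemHardy.exists_eLpNorm_le {q : ℝ} (hq : 0 < q) {Φ : ℂ → ℂ} (h : MemHardy q Φ) :
    ∃ M : NNReal, ∀ x : ℝ, 0 < x →
      eLpNorm (fun y : ℝ => Φ (x + y * Complex.I)) (ENNReal.ofReal q) ≤ M := by
  obtain ⟨M, hM⟩ := h.2
  set c : ENNReal := ENNReal.ofReal (1 / (2 * Real.pi)) ^ (1 / q) with hc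
  have hb : ENNReal.ofReal (1 / (2 * Real.pi)) ≠ 0 := by
    have := Real.pi_pos
    rw [Ne, ENNReal.ofReal_eq_zero, not_le]; positivity
  have hc0 : c ≠ 0 := (ENNReal.rpow_pos (pos_iff_ne_zero.2 hb) (by simp)).ne'
  have hct : c ≠ ⊤ := ENNReal.rpow_ne_top_of_nonneg (by positivity) (by simp)
  refine ⟨(M / c).toNNReal, fun x hx => ?_⟩
  rw [ENNReal.coe_toNNReal (ENNReal.div_ne_top (by simp) hc0), ENNReal.le_div_iff_mul_le
    (Or.inl hc0) (Or.inl hct), mul_comm]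
  have := hM x hx
  rwa [hardyMean, ENNReal.mul_rpow_of_nonneg _ _ (by positivity : 0 ≤ 1 / q), ← hc,
    ← ENNReal.toReal_ofReal hq.le,
    ← eLpNorm_eq_lintegral_rpow_enorm_toReal (by simpa using hq) (by simp)] at this

theorem lintegral_enorm_mul_le {α : Type*} [MeasurableSpace α] {μ : Measure α} {p p' : ℝ}
    (hpp : p.HolderConjugate p') {f g : α → ℂ} (hf : AEStronglyMeasurable f μ)
    (hg : AEStronglyMeasurable g μ) :
    ∫⁻ x, ‖f x * g x‖ₑ ∂μ ≤ eLpNorm f (ENNReal.ofReal p) μ * eLpNorm g (ENNReal.ofReal p') μ := by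
  have : ENNReal.HolderConjugate (ENNReal.ofReal p) (ENNReal.ofReal p') :=
    ⟨by rw [hpp.inv_add_inv_ennreal, inv_one]⟩
  have h := eLpNorm_smul_le_mul_eLpNorm (p := ENNReal.ofReal p) (q := ENNReal.ofReal p') (r := 1)
    hg hf
  rwa [eLpNorm_one_eq_lintegral_enorm] at h

theorem normSq_line_sub (x y : ℝ) (s : ℂ) :
    ‖(x : ℂ) + y * Complex.I - s‖ ^ 2 = (x - s.re) ^ 2 + (y - s.im) ^ 2 := by
  rw [Complex.sq_norm, Complex.normSq_apply]
  simp
  ring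

theorem line_sub_ne_zero {x : ℝ} {s : ℂ} (h : x ≠ s.re) (y : ℝ) :
    (x : ℂ) + y * Complex.I - s ≠ 0 := by
  intro h0
  have := congrArg Complex.re h0
  simp at this
  exact h (sub_eq_zero.1 this)

theorem continuous_inv_line_sub {x : ℝ} {s : ℂ} (h : x ≠ s.re) :
    Continuous fun y : ℝ => ((x : ℂ) + y * Complex.I - s)⁻¹ :=
  Continuous.inv₀ (by fun_prop) (line_sub_ne_zero h)

/-- The `L^q` norm of the Cauchy kernel on a vertical line at distance `d` is `O(d^{(1-q)/q})`. -/
theorem exists_eLpNorm_cauchyKernel_le {q : ℝ} (hq : 1 < q) :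
    ∃ C : NNReal, ∀ (x : ℝ) (s : ℂ), x ≠ s.re →
      eLpNorm (fun y : ℝ => ((x : ℂ) + y * Complex.I - s)⁻¹) (ENNReal.ofReal q) ≤
        C * ENNReal.ofReal (|x - s.re| ^ ((1 - q) / q)) := by
  have hI : Integrable fun y : ℝ => (1 + ‖y‖ ^ 2) ^ (-q / 2) :=
    integrable_rpow_neg_one_add_norm_sq (by simpa using hq)
  set A : ℝ := ∫ y : ℝ, (1 + ‖y‖ ^ 2) ^ (-q / 2) with hA
  have hA0 : 0 ≤ A := integral_nonneg fun y => by positivity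
  refine ⟨(A ^ (1 / q)).toNNReal, fun x s hx => ?_⟩
  set a := |x - s.re| with ha
  have ha0 : 0 < a := abs_pos.2 (sub_ne_zero.2 hx)
  -- Rescaling by `a = |x - Re s|` gives `a^(-q)`, and the change of variable contributes another
  -- `a`; the `q`-th root yields the exponent `(1 - q)/q`.
  have hpt : ∀ y : ℝ, ‖((x : ℂ) + y * Complex.I - s)⁻¹‖ₑ ^ q =
      ENNReal.ofReal (a ^ (-q) * (1 + ‖(y - s.im) / a‖ ^ 2) ^ (-q / 2)) := by
    intro y
    rw [← ofReal_norm, ENNReal.ofReal_rpow_of_nonneg (norm_nonneg _) (by linarith)]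
    congr 1
    have h1 := normSq_line_sub x y s
    have h2 : ‖(x : ℂ) + y * Complex.I - s‖ ^ 2 = a ^ 2 * (1 + ‖(y - s.im) / a‖ ^ 2) := by
      rw [h1, Real.norm_eq_abs, sq_abs ((y - s.im) / a), div_pow, ha, sq_abs]
      have : (x - s.re) ^ 2 ≠ 0 := pow_ne_zero _ (sub_ne_zero.2 hx)
      field_simp
    have h3 : ‖(x : ℂ) + y * Complex.I - s‖ =
        a * (1 + ‖(y - s.im) / a‖ ^ 2) ^ (1 / 2 : ℝ) := by
      rw [← Real.sqrt_eq_rpow, ← Real.sqrt_sq (norm_nonneg ((x : ℂ) + y * Complex.I - s)), h2,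
        Real.sqrt_mul (by positivity), Real.sqrt_sq ha0.le]
    rw [norm_inv, h3, Real.inv_rpow (by positivity), ← Real.rpow_neg (by positivity),
      Real.mul_rpow (by positivity) (by positivity), ← Real.rpow_mul (by positivity)]
    congr 2
    ring
  rw [eLpNorm_eq_lintegral_rpow_enorm_toReal (by simp; linarith) (by simp),
    ENNReal.toReal_ofReal (by linarith)]
  simp_rw [hpt]
  rw [← ofReal_integral_eq_lintegral_ofReal]
  · rw [integral_const_mul,
      integral_sub_right_eq_self (fun y => (1 + ‖y / a‖ ^ 2) ^ (-q / 2)),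
      Measure.integral_comp_div (fun y => (1 + ‖y‖ ^ 2) ^ (-q / 2)), ← hA, smul_eq_mul,
      abs_of_pos ha0, ← mul_assoc, ← Real.rpow_add_one ha0.ne',
      ENNReal.ofReal_rpow_of_nonneg (by positivity) (by positivity),
      Real.mul_rpow (by positivity) hA0, mul_comm, ENNReal.ofReal_mul (by positivity),
      ← Real.rpow_mul ha0.le]
    refine le_of_eq ?_
    congr 3
    ring
  · exact ((hI.comp_div ha0.ne').comp_sub_right s.im).const_mul _
  · exact ae_of_all _ fun y => by positivity

theorem memLp_cauchyKernel {q : ℝ} (hq : 1 < q) {x : ℝ} {s : ℂ} (h : x ≠ s.re) :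
    MemLp (fun y : ℝ => ((x : ℂ) + y * Complex.I - s)⁻¹) (ENNReal.ofReal q) := by
  obtain ⟨C, hC⟩ := exists_eLpNorm_cauchyKernel_le hq
  exact ⟨(continuous_inv_line_sub h).aestronglyMeasurable,
    (hC x s h).trans_lt (ENNReal.mul_lt_top (by simp) (by simp))⟩

theorem continuous_line {F : ℂ → ℂ} {c : ℝ} (hF : ContinuousOn F {z | c < z.re}) {x : ℝ}
    (hx : c < x) : Continuous fun y : ℝ => F (x + y * Complex.I) :=
  hF.comp_continuous (by fun_prop) fun y => by simpa using hx

/-- The integral of `F(z) / (z - s)` over vertical lines vanishes if `F(s) = 0`. -/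
theorem integral_mul_cauchyKernel_eq_zero {p p' : ℝ} (hpp : p.HolderConjugate p') {c σ : ℝ}
    (hc : c < σ) {F : ℂ → ℂ} (hF : DifferentiableOn ℂ F {z | c < z.re}) {M : NNReal}
    (hM : ∀ x : ℝ, σ ≤ x → eLpNorm (fun y : ℝ => F (x + y * Complex.I)) (ENNReal.ofReal p) ≤ M)
    {s : ℂ} (hs : σ < s.re) (hs0 : F s = 0) :
    ∫ y : ℝ, F (σ + y * Complex.I) * ((σ : ℂ) + y * Complex.I - s)⁻¹ = 0 := by
  set U : Set ℂ := {z | c < z.re} with hU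
  have hUo : IsOpen U := isOpen_lt continuous_const Complex.continuous_re
  -- Since `F s = 0`, the quotient `F(z)/(z - s)` is analytic across `s`, so its line integrals can
  -- be compared on both sides of `s`.
  set h := dslope F s with hh
  have hhd : DifferentiableOn ℂ h U :=
    (Complex.differentiableOn_dslope (hUo.mem_nhds (by simp [hU]; linarith))).2 hF
  have heq : ∀ z, z ≠ s → h z = F z * (z - s)⁻¹ := by
    intro z hz
    rw [hh, dslope_of_ne _ hz, slope_def_field, hs0, sub_zero, div_eq_mul_inv]
  have hline : ∀ x : ℝ, σ ≤ x → ∀ y : ℝ, ((x : ℂ) + y * Complex.I) ∈ U := by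
    intro x hx y
    simp [hU]; linarith
  have hFL : ∀ x : ℝ, σ ≤ x →
      MemLp (fun y : ℝ => F (x + y * Complex.I)) (ENNReal.ofReal p) := fun x hx =>
    ⟨(continuous_line hF.continuousOn (hc.trans_le hx)).aestronglyMeasurable,
      (hM x hx).trans_lt (by simp)⟩
  have : ENNReal.HolderConjugate (ENNReal.ofReal p) (ENNReal.ofReal p') :=
    ⟨by rw [hpp.inv_add_inv_ennreal, inv_one]⟩
  have hlineq : ∀ x : ℝ, x ≠ s.re → ∀ y : ℝ, h (x + y * Complex.I) =
      F (x + y * Complex.I) * ((x : ℂ) + y * Complex.I - s)⁻¹ := fun x hx y =>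
    heq _ (sub_ne_zero.1 (line_sub_ne_zero hx y))
  have hhi : ∀ x : ℝ, σ ≤ x → x ≠ s.re → Integrable fun y : ℝ => h (x + y * Complex.I) := by
    intro x hx hxs
    simp_rw [hlineq x hxs]
    exact (hFL x hx).integrable_mul (memLp_cauchyKernel hpp.symm.lt hxs)
  -- horizontal edges
  set T : Set ℝ := {Y | 1 ≤ |Y - s.im|} with hT
  have hTm : MeasurableSet T := measurableSet_le measurable_const (by fun_prop)
  have hedge : ∀ X : ℝ, σ ≤ X → Integrable (T.indicator fun Y : ℝ =>
      ∫ x in σ..X, h (x + Y * Complex.I)) := by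
    intro X hX
    rw [integrable_indicator_iff hTm]
    simp_rw [intervalIntegral.integral_of_le hX]
    have hprod : Integrable (fun q : ℝ × ℝ => h (q.2 + q.1 * Complex.I))
        ((volume.restrict T).prod (volume.restrict (Set.Ioc σ X))) := by
      have hmeas : AEStronglyMeasurable (fun q : ℝ × ℝ => h (q.2 + q.1 * Complex.I))
          ((volume.restrict T).prod (volume.restrict (Set.Ioc σ X))) := by
        rw [Measure.prod_restrict]
        refine ContinuousOn.aestronglyMeasurable ?_ (hTm.prod measurableSet_Ioc)
        exact hhd.continuousOn.comp (by fun_prop) fun q hq => hline _ hq.2.1.le _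
      refine ⟨hmeas, ?_⟩
      rw [HasFiniteIntegral, lintegral_prod_symm _ hmeas.enorm]
      have hk := (memLp_cauchyKernel hpp.symm.lt (x := s.re + 1) (s := s)
        (by simp)).const_mul (2 : ℂ)
      have hin : ∀ x ∈ Set.Ioc σ X, ∫⁻ Y in T, ‖h (x + Y * Complex.I)‖ₑ ≤ M * eLpNorm
          (fun y : ℝ => (2 : ℂ) * ((s.re + 1 : ℝ) + y * Complex.I - s)⁻¹) (ENNReal.ofReal p') := by
        intro x hx
        refine le_trans ?_ ((lintegral_enorm_mul_le hpp (hFL x hx.1.le).1 hk.1).trans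
          (mul_le_mul_left (hM x hx.1.le) _))
        refine (setLIntegral_mono' hTm fun Y hY => ?_).trans (setLIntegral_le_lintegral T _)
        have hY : 1 ≤ |Y - s.im| := hY
        have hne : (x : ℂ) + Y * Complex.I ≠ s := by
          rintro h0
          have := congrArg Complex.im h0
          simp at this
          rw [this, sub_self, abs_zero] at hY
          linarith
        rw [heq _ hne, enorm_mul, enorm_mul]
        refine mul_le_mul_right ?_ _
        rw [← ofReal_norm, ← ofReal_norm]
        refine ENNReal.ofReal_le_ofReal ?_
        rw [norm_mul, norm_inv, norm_inv, Complex.norm_ofNat, ← div_eq_mul_inv,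
          inv_eq_one_div, div_le_div_iff₀ (norm_pos_iff.2 (sub_ne_zero.2 hne))
          (norm_pos_iff.2 (line_sub_ne_zero (by simp) Y)), one_mul]
        refine le_of_sq_le_sq ?_ (by positivity)
        rw [mul_pow, normSq_line_sub, normSq_line_sub, ← sq_abs (Y - s.im)]
        nlinarith [sq_nonneg (x - s.re)]
      refine (setLIntegral_mono' measurableSet_Ioc hin).trans_lt ?_
      rw [setLIntegral_const]
      exact ENNReal.mul_lt_top (ENNReal.mul_lt_top (by simp) hk.2) (by simp)
    exact hprod.integral_prod_left
  have hconst : ∀ X : ℝ, s.re < X →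
      ∫ y : ℝ, h (X + y * Complex.I) = ∫ y : ℝ, h (σ + y * Complex.I) := by
    intro X hX
    set g : ℝ → ℂ := fun Y => ∫ x in σ..X, h (x + Y * Complex.I) with hg
    have hi := hedge X (hs.trans hX).le
    have hi2 := hi.sub (hi.comp_neg)
    have hlim : ∀ x : ℝ, σ ≤ x → x ≠ s.re → Tendsto (fun Y : ℝ => ∫ y in (-Y)..Y,
        h (x + y * Complex.I)) atTop (𝓝 (∫ y : ℝ, h (x + y * Complex.I))) := fun x hx hxs =>
      intervalIntegral_tendsto_integral (hhi x hx hxs) tendsto_neg_atTop_atBot tendsto_id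
    have hD : Tendsto (fun Y => T.indicator g Y - T.indicator g (-Y)) atTop
        (𝓝 (Complex.I * ((∫ y : ℝ, h (X + y * Complex.I)) - ∫ y : ℝ, h (σ + y * Complex.I)))) := by
      refine ((((hlim X (hs.trans hX).le hX.ne').sub (hlim σ le_rfl hs.ne)).const_mul
        Complex.I)).congr' ?_
      filter_upwards [eventually_ge_atTop (|s.im| + 1)] with Y hY
      have h1 := le_abs_self s.im
      have h2 := neg_abs_le s.im
      rw [Set.indicator_of_mem (show Y ∈ T by
          rw [hT, Set.mem_ofPred_eq, le_abs]; left; linarith),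
        Set.indicator_of_mem (show -Y ∈ T by
          rw [hT, Set.mem_ofPred_eq, le_abs]; right; linarith)]
      have hrect := Complex.integral_boundary_rect_eq_zero_of_differentiableOn h
        ((σ : ℂ) + (-Y : ℝ) * Complex.I) ((X : ℂ) + Y * Complex.I) (hhd.mono ?_)
      · simp at hrect
        simp only [hg, Complex.ofReal_neg, neg_mul]
        linear_combination hrect
      · intro z hz
        have := hz.1
        simp [Set.uIcc_of_le (hs.trans hX).le] at this
        simp [hU]; linarith [this.1]
    -- The difference of the top and bottom edges has a limit as `Y → ∞`, by convergence of the
    -- vertical integrals, and is integrable, so the limit is zero.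
    have h0 := IntegrableAtFilter.eq_zero_of_tendsto (hi2.integrableAtFilter atTop) (by
      intro S hS
      obtain ⟨b, hb⟩ := mem_atTop_sets.1 hS
      rw [← top_le_iff, ← Real.volume_Ici (a := b)]
      exact measure_mono hb) hD
    exact sub_eq_zero.1 ((mul_eq_zero.1 h0).resolve_left Complex.I_ne_zero)
  have hσ : ∫ y : ℝ, h (σ + y * Complex.I) = 0 := by
    -- The common value is independent of `X`, while Hölder bounds it by a negative power of `X - Re
    -- s`; letting `X → ∞` gives zero.
    obtain ⟨C, hC⟩ := exists_eLpNorm_cauchyKernel_le hpp.symm.lt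
    have hb : ∀ X : ℝ, s.re < X → ‖∫ y : ℝ, h (σ + y * Complex.I)‖ₑ ≤
        M * (C * ENNReal.ofReal ((X - s.re) ^ ((1 - p') / p'))) := by
      intro X hX
      rw [← hconst X hX]
      refine (enorm_integral_le_lintegral_enorm _).trans ?_
      simp_rw [hlineq X hX.ne']
      refine (lintegral_enorm_mul_le hpp (hFL X (hs.trans hX).le).1
        (memLp_cauchyKernel hpp.symm.lt hX.ne').1).trans ?_
      refine mul_le_mul' (hM X (hs.trans hX).le) ?_
      have := hC X s hX.ne'
      rwa [abs_of_pos (sub_pos.2 hX)] at this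
    have hlim : Tendsto (fun X : ℝ => (M : ENNReal) *
        (C * ENNReal.ofReal ((X - s.re) ^ ((1 - p') / p')))) atTop (𝓝 0) := by
      have h1 : Tendsto (fun X : ℝ => (X - s.re) ^ ((1 - p') / p')) atTop (𝓝 0) := by
        have h2 := tendsto_rpow_neg_atTop (y := (p' - 1) / p')
          (div_pos hpp.symm.sub_one_pos hpp.symm.pos)
        refine (h2.comp (tendsto_atTop_add_const_right atTop (-s.re) tendsto_id)).congr fun X => ?_
        simp only [Function.comp, id]
        rw [← sub_eq_add_neg]
        congr 1
        ring
      have h3 := ENNReal.tendsto_ofReal h1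
      rw [ENNReal.ofReal_zero] at h3
      have h4 := ENNReal.Tendsto.const_mul (a := C) h3 (Or.inr (by simp))
      have h5 := ENNReal.Tendsto.const_mul (a := M) h4 (Or.inr (by simp))
      simpa using h5
    have := ge_of_tendsto hlim ((eventually_gt_atTop s.re).mono hb)
    simpa using this
  rw [← hσ]
  exact integral_congr_ae (ae_of_all _ fun y => (hlineq σ hs.ne y).symm)

theorem integral_poissonKernel {a : ℝ} (ha : 0 < a) (b : ℝ) :
    ∫ y : ℝ, (a ^ 2 + (y - b) ^ 2)⁻¹ = Real.pi / a := by
  rw [integral_sub_right_eq_self (fun y => (a ^ 2 + y ^ 2)⁻¹)]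
  have h1 : ∀ y : ℝ, (a ^ 2 + y ^ 2)⁻¹ = (a ^ 2)⁻¹ * (1 + (y / a) ^ 2)⁻¹ := by
    intro y
    field_simp
  simp_rw [h1]
  rw [integral_const_mul, Measure.integral_comp_div (fun y => (1 + y ^ 2)⁻¹),
    integral_univ_inv_one_add_sq, smul_eq_mul, abs_of_pos ha]
  field_simp

/-- Cauchy's formula on a half-plane for a function in the Hardy space. -/
theorem integral_mul_cauchyKernel {p p' : ℝ} (hpp : p.HolderConjugate p') {F : ℂ → ℂ}
    (hF : DifferentiableOn ℂ F rightHalfPlane) {M : NNReal}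
    (hM : ∀ x : ℝ, 0 < x → eLpNorm (fun y : ℝ => F (x + y * Complex.I)) (ENNReal.ofReal p) ≤ M)
    {σ : ℝ} (hσ : 0 < σ) {s : ℂ} (hs : σ < s.re) :
    ∫ y : ℝ, F (σ + y * Complex.I) * (s - ((σ : ℂ) + y * Complex.I))⁻¹ = 2 * Real.pi * F s := by
  -- `ζ` is the reflection of `s` in the line `Re z = σ`, and `K = F(s)(s - ζ)`, so `F(z) - K/(z -
  -- ζ)` vanishes at `s` and is analytic to the right of `c`. On the line `(z - ζ)(z - s)` is minus
  -- the Poisson denominator, so the correction integrates explicitly.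
  set ζ : ℂ := 2 * σ - starRingEnd ℂ s with hζ
  have hζre : ζ.re = 2 * σ - s.re := by simp [hζ]
  set a : ℝ := s.re - σ with ha
  have ha0 : 0 < a := sub_pos.2 hs
  set K : ℂ := F s * (2 * a) with hK
  set c : ℝ := max 0 ζ.re with hcd
  have hc : c < σ := max_lt hσ (by rw [hζre]; linarith)
  have hw : DifferentiableOn ℂ (fun z : ℂ => K * (z - ζ)⁻¹) {z | c < z.re} := by
    refine DifferentiableOn.const_mul (DifferentiableOn.inv (by fun_prop) fun z hz h0 => ?_) _
    have h1 : ζ.re < z.re := (le_max_right _ _).trans_lt hz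
    rw [sub_eq_zero.1 h0] at h1
    exact lt_irrefl _ h1
  have hwL : ∀ x : ℝ, σ ≤ x →
      MemLp (fun y : ℝ => K * ((x : ℂ) + y * Complex.I - ζ)⁻¹) (ENNReal.ofReal p) := fun x hx =>
    (memLp_cauchyKernel hpp.lt (by rw [hζre]; linarith)).const_mul _
  set B : ENNReal := M + eLpNorm (fun y : ℝ => K * ((σ : ℂ) + y * Complex.I - ζ)⁻¹)
    (ENNReal.ofReal p) with hB
  have hBt : B ≠ ⊤ := ENNReal.add_ne_top.2 ⟨by simp, (hwL σ le_rfl).2.ne⟩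
  have hFL : ∀ x : ℝ, σ ≤ x →
      MemLp (fun y : ℝ => F (x + y * Complex.I)) (ENNReal.ofReal p) := fun x hx =>
    ⟨(continuous_line hF.continuousOn (hσ.trans_le hx)).aestronglyMeasurable,
      (hM x (hσ.trans_le hx)).trans_lt (by simp)⟩
  have hsζ : s - ζ = 2 * a := by
    apply Complex.ext <;> simp [hζ, ha]
    ring
  have key := integral_mul_cauchyKernel_eq_zero hpp hc (F := fun z => F z - K * (z - ζ)⁻¹)
    (M := B.toNNReal) (DifferentiableOn.fun_sub
      (hF.mono fun z (hz : c < z.re) => (le_max_left _ _).trans_lt hz) hw) (by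
      intro x hx
      rw [ENNReal.coe_toNNReal hBt]
      refine (eLpNorm_sub_le (hFL x hx).1 (hwL x hx).1
        (by rw [← ENNReal.ofReal_one]; exact ENNReal.ofReal_le_ofReal hpp.lt.le)).trans ?_
      refine add_le_add (hM x (hσ.trans_le hx)) (eLpNorm_mono fun y => ?_)
      rw [norm_mul K, norm_mul K, norm_inv, norm_inv]
      have h1 : 0 < ‖(σ : ℂ) + y * Complex.I - ζ‖ :=
        norm_pos_iff.2 (line_sub_ne_zero (by rw [hζre]; linarith) y)
      gcongr
      refine le_of_sq_le_sq ?_ (norm_nonneg _)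
      rw [normSq_line_sub, normSq_line_sub, hζre]
      nlinarith) hs (by
      rw [hsζ, hK]
      have : (a : ℂ) ≠ 0 := by exact_mod_cast ha0.ne'
      field_simp
      ring)
  have : ENNReal.HolderConjugate (ENNReal.ofReal p) (ENNReal.ofReal p') :=
    ⟨by rw [hpp.inv_add_inv_ennreal, inv_one]⟩
  have hk := memLp_cauchyKernel hpp.symm.lt hs.ne
  simp_rw [sub_mul] at key
  have hi1 : Integrable fun y : ℝ => F (σ + y * Complex.I) * ((σ : ℂ) + y * Complex.I - s)⁻¹ :=
    (hFL σ le_rfl).integrable_mul hk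
  have hi2 : Integrable fun y : ℝ => K * ((σ : ℂ) + y * Complex.I - ζ)⁻¹ *
      ((σ : ℂ) + y * Complex.I - s)⁻¹ := (hwL σ le_rfl).integrable_mul hk
  rw [integral_sub hi1 hi2] at key
  have hP : ∀ y : ℝ, K * ((σ : ℂ) + y * Complex.I - ζ)⁻¹ * ((σ : ℂ) + y * Complex.I - s)⁻¹ =
      -K * (((a ^ 2 + (y - s.im) ^ 2)⁻¹ : ℝ) : ℂ) := by
    intro y
    have : ((σ : ℂ) + y * Complex.I - ζ) * ((σ : ℂ) + y * Complex.I - s) =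
        -((a ^ 2 + (y - s.im) ^ 2 : ℝ) : ℂ) := by
      apply Complex.ext <;> simp [hζ, ha, sq] <;> ring
    rw [mul_assoc, ← mul_inv, this, Complex.ofReal_inv, inv_neg]
    ring
  simp_rw [hP] at key
  rw [integral_const_mul, integral_complex_ofReal, integral_poissonKernel ha0] at key
  have h1 : ∀ y : ℝ, F (σ + y * Complex.I) * (s - ((σ : ℂ) + y * Complex.I))⁻¹ =
      -(F (σ + y * Complex.I) * ((σ : ℂ) + y * Complex.I - s)⁻¹) := by
    intro y
    rw [← neg_sub s, inv_neg]
    ring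
  simp_rw [h1]
  rw [integral_neg, sub_eq_zero.1 key, hK]
  have : (a : ℂ) ≠ 0 := by exact_mod_cast ha0.ne'
  push_cast
  field_simp

/-! ### Bromwich inversion on the Hardy space. -/

instance sFinite_halfLine : SFinite halfLine := by
  unfold halfLine
  infer_instance

/-- The inverse Fourier integral `(2π)⁻¹ ∫ e^{iηt} g(η) dη`. -/
noncomputable def fourierSynthesis (g : ℝ → ℂ) (t : ℝ) : ℂ :=
  (1 / (2 * (Real.pi : ℂ))) * ∫ η : ℝ, Complex.exp ((η : ℂ) * Complex.I * t) * g η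

open FourierTransform in
theorem fourierSynthesis_eq (g : ℝ → ℂ) (t : ℝ) :
    fourierSynthesis g t = (1 / (2 * (Real.pi : ℂ))) * 𝓕 g (-(1 / (2 * Real.pi)) * t) := by
  rw [fourierSynthesis, Real.fourier_real_eq_integral_exp_smul]
  congr 1
  refine integral_congr_ae (ae_of_all _ fun η => ?_)
  simp only [smul_eq_mul]
  congr 2
  push_cast
  have : (Real.pi : ℂ) ≠ 0 := by exact_mod_cast Real.pi_ne_zero
  field_simp

theorem continuous_fourierSynthesis {g : ℝ → ℂ} (hg : Integrable g) :
    Continuous (fourierSynthesis g) := by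
  have : fourierSynthesis g = fun t => (1 / (2 * (Real.pi : ℂ))) *
      (FourierTransform.fourier g : ℝ → ℂ) (-(1 / (2 * Real.pi)) * t) :=
    funext (fourierSynthesis_eq g)
  rw [this]
  have hc : Continuous (FourierTransform.fourier g : ℝ → ℂ) :=
    VectorFourier.fourierIntegral_continuous Real.continuous_fourierChar continuous_inner hg
  fun_prop

theorem fourierSynthesis_sub {f g : ℝ → ℂ} (hf : Integrable f) (hg : Integrable g) :
    fourierSynthesis (f - g) = fourierSynthesis f - fourierSynthesis g := by
  have hi : ∀ {h : ℝ → ℂ}, Integrable h → ∀ t : ℝ,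
      Integrable fun η : ℝ => Complex.exp ((η : ℂ) * Complex.I * t) * h η := by
    intro h hh t
    refine hh.bdd_mul (c := 1) (by fun_prop) (ae_of_all _ fun η => ?_)
    rw [mul_right_comm, ← Complex.ofReal_mul, Complex.norm_exp_ofReal_mul_I]
  ext t
  simp only [fourierSynthesis, Pi.sub_apply, mul_sub]
  rw [integral_sub (hi hf t) (hi hg t), mul_sub]

/-- The Hausdorff-Young inequality for `fourierSynthesis`. -/
theorem exists_eLpNorm_fourierSynthesis_le {p p' : ℝ} (hp2 : p ≤ 2)
    (hpp : p.HolderConjugate p') :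
    ∃ C : NNReal, ∀ g : ℝ → ℂ, Measurable g → Integrable g → MemLp g (ENNReal.ofReal p) →
      eLpNorm (fourierSynthesis g) (ENNReal.ofReal p') halfLine ≤
        C * eLpNorm g (ENNReal.ofReal p) := by
  obtain ⟨C, hC⟩ := exists_eLpNorm_fourier_le hpp.lt hp2 hpp
  set c : ℝ := -(1 / (2 * Real.pi)) with hc
  have hc0 : c ≠ 0 := by
    have := Real.pi_pos
    rw [hc, neg_ne_zero]; positivity
  set D : ENNReal := ‖1 / (2 * (Real.pi : ℂ))‖ₑ *
    (ENNReal.ofReal |c⁻¹| ^ (1 / (ENNReal.ofReal p').toReal)) with hD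
  have hDt : D ≠ ⊤ := ENNReal.mul_ne_top enorm_ne_top
    (ENNReal.rpow_ne_top_of_nonneg (by positivity) (by simp))
  refine ⟨D.toNNReal * C, fun g hgm hg hgp => ?_⟩
  have hcont : Continuous (FourierTransform.fourier g : ℝ → ℂ) :=
    VectorFourier.fourierIntegral_continuous Real.continuous_fourierChar continuous_inner hg
  have hb := hC g hgm hg hgp
  have h1 := funext (fourierSynthesis_eq g)
  rw [← hc] at h1
  generalize (FourierTransform.fourier g : ℝ → ℂ) = φ at hcont hb h1
  have h2 : (fun t => 1 / (2 * (Real.pi : ℂ)) * φ (c * t)) =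
      (1 / (2 * (Real.pi : ℂ))) • (φ ∘ fun t => c * t) := rfl
  have h3 : eLpNorm (φ ∘ fun t => c * t) (ENNReal.ofReal p') =
      ENNReal.ofReal |c⁻¹| ^ (1 / (ENNReal.ofReal p').toReal) *
        eLpNorm φ (ENNReal.ofReal p') := by
    rw [← eLpNorm_map_measure hcont.aestronglyMeasurable (by fun_prop),
      Real.map_volume_mul_left hc0, eLpNorm_smul_measure_of_ne_top (by simp), smul_eq_mul]
    simp
  rw [h1, h2, halfLine]
  refine (eLpNorm_mono_measure _ Measure.restrict_le_self).trans ?_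
  rw [eLpNorm_const_smul, h3, ENNReal.coe_mul, ENNReal.coe_toNNReal hDt, hD, mul_assoc, mul_assoc]
  gcongr

/-- Truncations converge in the mean. -/
theorem tendsto_eLpNorm_sub_indicator {p : ℝ} (hp : 0 < p) {g : ℝ → ℂ}
    (hg : MemLp g (ENNReal.ofReal p)) :
    Tendsto (fun v : ℝ => eLpNorm ((Set.Ioc (-v) v).indicator g - g) (ENNReal.ofReal p))
      atTop (𝓝 0) := by
  simp_rw [eLpNorm_eq_lintegral_rpow_enorm_toReal (show ENNReal.ofReal p ≠ 0 by simpa using hp)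
    ENNReal.ofReal_ne_top, ENNReal.toReal_ofReal hp.le]
  have hfin : ∫⁻ x, ‖g x‖ₑ ^ p ≠ ⊤ := by
    have := lintegral_rpow_enorm_lt_top_of_eLpNorm_lt_top (by simpa using hp)
      ENNReal.ofReal_ne_top hg.2
    rw [ENNReal.toReal_ofReal hp.le] at this
    exact this.ne
  have h1 : Tendsto (fun v : ℝ => ∫⁻ x, ‖((Set.Ioc (-v) v).indicator g - g) x‖ₑ ^ p) atTop
      (𝓝 (∫⁻ _ : ℝ, 0)) := by
    refine tendsto_lintegral_filter_of_dominated_convergence' (fun x => ‖g x‖ₑ ^ p)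
      (Eventually.of_forall fun v => ?_) (Eventually.of_forall fun v => ae_of_all _ fun x => ?_)
      hfin (ae_of_all _ fun x => ?_)
    · exact ((hg.1.indicator measurableSet_Ioc).sub hg.1).enorm.pow_const _
    · refine ENNReal.rpow_le_rpow ?_ hp.le
      by_cases hx : x ∈ Set.Ioc (-v) v
      · simp [hx]
      · simp [hx]
    · refine tendsto_const_nhds.congr' ?_
      filter_upwards [eventually_gt_atTop |x|] with v hv
      have hx : x ∈ Set.Ioc (-v) v := ⟨(abs_lt.1 hv).1, (abs_lt.1 hv).2.le⟩
      simp [hx, hp]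
  rw [lintegral_zero] at h1
  have h2 := h1.ennrpow_const (1 / p)
  rwa [ENNReal.zero_rpow_of_pos (by positivity)] at h2

/-- Fubini and the transform `1/(z - iη)` of `e^{iηt}`: the result is a Cauchy integral, ready for
`integral_mul_cauchyKernel`. -/
theorem laplace_fourierSynthesis {g : ℝ → ℂ} (hg : Integrable g) {z : ℂ} (hz : 0 < z.re) :
    laplace (fourierSynthesis g) z =
      (1 / (2 * (Real.pi : ℂ))) * ∫ η : ℝ, g η * (z - η * Complex.I)⁻¹ := by
  have h1 : ∀ t : ℝ, Complex.exp (-z * t) * fourierSynthesis g t = (1 / (2 * (Real.pi : ℂ))) *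
      ∫ η : ℝ, Complex.exp (-z * t) * (Complex.exp ((η : ℂ) * Complex.I * t) * g η) := by
    intro t
    rw [integral_const_mul, fourierSynthesis, mul_left_comm]
  rw [laplace]
  simp_rw [h1]
  rw [integral_const_mul, integral_integral_swap]
  · congr 1
    refine integral_congr_ae (ae_of_all _ fun η => ?_)
    have hre : (η * Complex.I - z).re < 0 := by simpa using hz
    have := integral_pow_mul_exp 0 hre
    simp only [pow_zero, one_mul, zero_add, pow_one, Nat.factorial_zero, Nat.cast_one,
      neg_sub, one_div] at this
    simp only
    rw [← this, ← integral_const_mul]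
    refine integral_congr_ae (ae_of_all _ fun t => ?_)
    simp only
    rw [← mul_assoc, ← Complex.exp_add, mul_comm]
    congr 2
    ring
  · have he : Integrable (fun t : ℝ => Complex.exp (-z * t)) halfLine := by
      simpa using integrable_pow_mul_exp 0 (s := -z) (by simpa using hz)
    have hp : Integrable (fun q : ℝ × ℝ => Complex.exp (-z * q.1) * g q.2) (halfLine.prod volume) :=
      he.mul_prod hg
    have hb := hp.bdd_mul (f := fun q : ℝ × ℝ => Complex.exp ((q.2 : ℂ) * Complex.I * q.1)) (c := 1)
      (by fun_prop) (ae_of_all _ fun q => by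
        rw [mul_right_comm, ← Complex.ofReal_mul, Complex.norm_exp_ofReal_mul_I])
    refine hb.congr (ae_of_all _ fun q => ?_)
    simp only [Function.uncurry]
    ring

/-- The weight cancels `e^{σt}`, so weighted convergence of the truncations becomes a question about
the Fourier synthesis of truncated data on the line. -/
theorem bromwichTrunc_eq (F : ℂ → ℂ) (σ : ℝ) {v : ℝ} (hv : 0 ≤ v) (t : ℝ) :
    Complex.exp (-((σ : ℂ) * t)) * bromwichTrunc F σ v t =
      fourierSynthesis ((Set.Ioc (-v) v).indicator fun η : ℝ => F (σ + η * Complex.I)) t := by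
  rw [bromwichTrunc, fourierSynthesis, intervalIntegral.integral_of_le (by linarith),
    mul_left_comm, ← integral_const_mul, ← integral_indicator measurableSet_Ioc]
  congr 1
  refine integral_congr_ae (ae_of_all _ fun η => ?_)
  by_cases hη : η ∈ Set.Ioc (-v) v
  · simp only [Set.indicator_of_mem hη]
    rw [← mul_assoc, ← Complex.exp_add]
    congr 2
    ring
  · simp [hη]

/-- The limit in the mean of the truncated Bromwich integrals on a fixed vertical line. -/
theorem exists_bromwich_limit {p p' : ℝ} (hp2 : p ≤ 2) (hpp : p.HolderConjugate p') :
    ∃ C : NNReal, ∀ (F : ℂ → ℂ) (M : NNReal), DifferentiableOn ℂ F rightHalfPlane →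
      (∀ x : ℝ, 0 < x →
        eLpNorm (fun y : ℝ => F (x + y * Complex.I)) (ENNReal.ofReal p) ≤ M) →
      ∀ σ : ℝ, 0 < σ → ∃ h : ℝ → ℂ, MemLp h (ENNReal.ofReal p') halfLine ∧
        eLpNorm h (ENNReal.ofReal p') halfLine ≤ C * M ∧
        Tendsto (fun v : ℝ => eLpNorm (fun t : ℝ =>
          Complex.exp (-((σ : ℂ) * t)) * bromwichTrunc F σ v t - h t) (ENNReal.ofReal p') halfLine)
          atTop (𝓝 0) ∧
        ∀ s : ℂ, σ < s.re → laplace h (s - σ) = F s := by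
  obtain ⟨C, hC⟩ := exists_eLpNorm_fourierSynthesis_le hp2 hpp
  -- The constant comes from Hausdorff-Young alone and does not depend on `σ`; this uniformity later
  -- permits `σ → 0`.
  refine ⟨C, fun F M hF hM σ hσ => ?_⟩
  have hp1' : Fact (1 ≤ ENNReal.ofReal p) := ⟨by
    rw [← ENNReal.ofReal_one]; exact ENNReal.ofReal_le_ofReal hpp.lt.le⟩
  have hp2' : Fact (1 ≤ ENNReal.ofReal p') := ⟨by
    rw [← ENNReal.ofReal_one]; exact ENNReal.ofReal_le_ofReal hpp.symm.lt.le⟩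
  set g : ℝ → ℂ := fun η => F (σ + η * Complex.I) with hg
  have hgc : Continuous g := continuous_line hF.continuousOn hσ
  have hgL : MemLp g (ENNReal.ofReal p) :=
    ⟨hgc.aestronglyMeasurable, (hM σ hσ).trans_lt (by simp)⟩
  set k : ℝ → ℝ → ℂ := fun v => (Set.Ioc (-v) v).indicator g with hk
  have hkm : ∀ v, Measurable (k v) := fun v => hgc.measurable.indicator measurableSet_Ioc
  have hki : ∀ v, Integrable (k v) := fun v =>
    (integrable_indicator_iff measurableSet_Ioc).2
      (hgc.integrableOn_Icc.mono_set Set.Ioc_subset_Icc_self)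
  have hkL : ∀ v, MemLp (k v) (ENNReal.ofReal p) := fun v => hgL.indicator measurableSet_Ioc
  have hkt := tendsto_eLpNorm_sub_indicator hpp.pos hgL
  have hSL : ∀ v, MemLp (fourierSynthesis (k v)) (ENNReal.ofReal p') halfLine := fun v =>
    ⟨(continuous_fourierSynthesis (hki v)).aestronglyMeasurable,
      (hC _ (hkm v) (hki v) (hkL v)).trans_lt (ENNReal.mul_lt_top (by simp) (hkL v).2)⟩
  set G : ℝ → Lp ℂ (ENNReal.ofReal p) volume := fun v => (hkL v).toLp (k v) with hG
  set U : ℝ → Lp ℂ (ENNReal.ofReal p') halfLine := fun v => (hSL v).toLp _ with hU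
  have hGt : Tendsto G atTop (𝓝 (hgL.toLp g)) :=
    (Lp.tendsto_Lp_iff_tendsto_eLpNorm'' _ _ _ _).2 hkt
  have hUG : ∀ u v, edist (U u) (U v) ≤ C * edist (G u) (G v) := by
    intro u v
    rw [hU, hG, Lp.edist_toLp_toLp, Lp.edist_toLp_toLp, ← fourierSynthesis_sub (hki u) (hki v)]
    exact hC _ ((hkm u).sub (hkm v)) ((hki u).sub (hki v)) ((hkL u).sub (hkL v))
  have hUc : CauchySeq U := by
    rw [EMetric.cauchySeq_iff]
    intro ε hε
    -- Dividing by `C + 1` rather than `C` covers `C = 0`.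
    obtain ⟨N, hN⟩ := EMetric.cauchySeq_iff.1 hGt.cauchySeq (ε / (C + 1))
      (ENNReal.div_pos hε.ne' (by simp))
    refine ⟨N, fun m hm n hn => ?_⟩
    have h1 := hN m hm n hn
    rw [ENNReal.lt_div_iff_mul_lt (by simp) (by simp)] at h1
    refine (hUG m n).trans_lt (lt_of_le_of_lt ?_ h1)
    rw [mul_comm]
    gcongr
    exact le_self_add
  obtain ⟨H, hH⟩ := cauchySeq_tendsto_of_complete hUc
  have hHt : Tendsto (fun v => eLpNorm (fourierSynthesis (k v) - (H : ℝ → ℂ)) (ENNReal.ofReal p') halfLine)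
      atTop (𝓝 0) := by
    have := (Lp.tendsto_Lp_iff_tendsto_eLpNorm' _ _).1 hH
    refine this.congr fun v => eLpNorm_congr_ae ?_
    filter_upwards [(hSL v).coeFn_toLp] with t ht
    simp [hU, ht]
  refine ⟨H, Lp.memLp H, ?_, ?_, ?_⟩
  · rw [← Lp.enorm_def]
    refine le_of_tendsto hH.enorm (Eventually.of_forall fun v => ?_)
    rw [Lp.enorm_def, eLpNorm_congr_ae (hSL v).coeFn_toLp]
    refine (hC _ (hkm v) (hki v) (hkL v)).trans ?_
    gcongr
    exact (eLpNorm_indicator_le g).trans (hM σ hσ)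
  · refine hHt.congr' ?_
    filter_upwards [eventually_ge_atTop 0] with v hv
    congr 1
    ext t
    rw [bromwichTrunc_eq F σ hv t]
    rfl
  · intro s hs
    have hz : 0 < (s - σ).re := by simpa using hs
    have hexp := memLp_exp hpp.pos hz
    have hL : Tendsto (fun v => laplace (fourierSynthesis (k v)) (s - σ)) atTop
        (𝓝 (laplace H (s - σ))) := by
      rw [tendsto_iff_edist_tendsto_0]
      have hup := ENNReal.Tendsto.const_mul (a := eLpNorm (fun t : ℝ =>
        Complex.exp (-(s - σ) * t)) (ENNReal.ofReal p) halfLine) hHt (Or.inr hexp.2.ne)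
      rw [mul_zero] at hup
      refine tendsto_of_tendsto_of_tendsto_of_le_of_le tendsto_const_nhds hup
        (fun _ => zero_le) fun v => ?_
      simp only [laplace]
      rw [edist_eq_enorm_sub, ← integral_sub (integrable_exp_mul hpp (hSL v) hz)
        (integrable_exp_mul hpp (Lp.memLp H) hz)]
      refine (enorm_integral_le_lintegral_enorm _).trans ?_
      simp_rw [← mul_sub]
      exact lintegral_enorm_mul_le hpp hexp.1 ((hSL v).1.sub (Lp.memLp H).1)
    have : ENNReal.HolderConjugate (ENNReal.ofReal p) (ENNReal.ofReal p') :=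
      ⟨by rw [hpp.inv_add_inv_ennreal, inv_one]⟩
    have hker : ∀ η : ℝ, (s - σ - η * Complex.I)⁻¹ = -((σ : ℂ) + η * Complex.I - s)⁻¹ := by
      intro η
      rw [← inv_neg]
      congr 1
      ring
    have hint : Integrable fun η : ℝ => g η * (s - σ - η * Complex.I)⁻¹ := by
      simp_rw [hker]
      exact hgL.integrable_mul (memLp_cauchyKernel hpp.symm.lt hs.ne).neg
    have hR := (intervalIntegral_tendsto_integral hint tendsto_neg_atTop_atBot
      tendsto_id).const_mul (1 / (2 * (Real.pi : ℂ)))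
    refine tendsto_nhds_unique hL ((hR.congr' ?_).trans (le_of_eq ?_))
    · filter_upwards [eventually_ge_atTop 0] with v hv
      rw [laplace_fourierSynthesis (hki v) hz, id,
        intervalIntegral.integral_of_le (by linarith), ← integral_indicator measurableSet_Ioc]
      congr 2
      ext η
      by_cases hη : η ∈ Set.Ioc (-v) v <;> simp [hk, hη]
    · have := integral_mul_cauchyKernel hpp hF hM hσ hs
      simp_rw [← sub_sub] at this
      rw [this]
      have hpi : (Real.pi : ℂ) ≠ 0 := by exact_mod_cast Real.pi_ne_zero
      congr 1
      field_simp

/-- Every function in `H^p(ℂ₊)`, `1 < p ≤ 2`, is the Laplace transform of a function in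
`L^{p'}(ℝ₊)`, which is given by the Bromwich integral on every vertical line. -/
theorem MemHardy.exists_isInverseLaplace {p p' : ℝ} (hp2 : p ≤ 2) (hpp : p.HolderConjugate p')
    {F : ℂ → ℂ} (hF : MemHardy p F) :
    ∃ b : ℝ → ℂ, IsInverseLaplace p' F b ∧ ∀ σ : ℝ, 0 < σ → IsBromwichIntegral p' F σ b := by
  obtain ⟨C, hC⟩ := exists_bromwich_limit hp2 hpp
  obtain ⟨M, hM⟩ := hF.exists_eLpNorm_le hpp.pos
  have hlim := hC F M hF.1 hM
  choose! h hhL hhb hht hhl using hlim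
  set B : ℝ → ℝ → ℂ := fun σ t => Complex.exp ((σ : ℂ) * t) * h σ t with hB
  have hBc : ∀ (c σ t : ℝ), Complex.exp (-(c : ℂ) * t) * B σ t =
      Complex.exp (-((c - σ : ℝ) : ℂ) * t) * h σ t := by
    intro c σ t
    rw [hB]
    simp only
    rw [← mul_assoc, ← Complex.exp_add]
    congr 2
    push_cast
    ring
  have hBi : ∀ c σ : ℝ, 0 < σ → σ < c →
      Integrable (fun t : ℝ => Complex.exp (-(c : ℂ) * t) * B σ t) halfLine := by
    intro c σ hσ hc
    simp_rw [hBc]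
    exact integrable_exp_mul hpp (hhL σ hσ) (by simpa using hc)
  have hBl : ∀ σ : ℝ, 0 < σ → ∀ s : ℂ, σ < s.re → laplace (B σ) s = F s := by
    intro σ hσ s hs
    rw [← hhl σ hσ s hs, laplace, laplace]
    refine integral_congr_ae (ae_of_all _ fun t => ?_)
    simp only [hB]
    rw [← mul_assoc, ← Complex.exp_add]
    congr 2
    ring
  have hBB : ∀ σ : ℝ, 0 < σ → B 1 =ᵐ[halfLine] B σ := by
    intro σ hσ
    -- The line `Re s = σ + 2` lies to the right of both `1` and `σ`, so both transforms equal `F`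
    -- there.
    refine ae_eq_of_laplace_ae_eq (c := σ + 1 + 1) (hBi _ _ one_pos (by linarith))
      (hBi _ _ hσ (by linarith)) (ae_of_all _ fun η => ?_)
    rw [hBl 1 one_pos _ (by simp; linarith), hBl σ hσ _ (by simp; linarith)]
  have hBm : AEStronglyMeasurable (B 1) halfLine :=
    (measurable_cexp_mul _).aestronglyMeasurable.mul (hhL 1 one_pos).1
  have hBh : ∀ σ : ℝ, 0 < σ →
      (fun t : ℝ => Complex.exp (-((σ : ℂ) * t)) * B 1 t) =ᵐ[halfLine] h σ := by
    intro σ hσ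
    filter_upwards [hBB σ hσ] with t ht
    rw [ht, hB]
    simp only
    rw [← mul_assoc, ← Complex.exp_add, neg_add_cancel, Complex.exp_zero, one_mul]
  have hBL : MemLp (B 1) (ENNReal.ofReal p') halfLine := by
    refine ⟨hBm, lt_of_le_of_lt ?_ (ENNReal.mul_lt_top (a := C) (b := M) (by simp) (by simp))⟩
    -- Fatou along `σ = 1/(n+1)`: `e^{-σt} B 1` agrees a.e. with `h σ`, whose norm is at most `C *
    -- M` for every `σ`.
    refine (Lp.eLpNorm_lim_le_liminf_eLpNorm (f := fun n : ℕ => fun t : ℝ =>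
      Complex.exp (-(((1 / ((n : ℝ) + 1) : ℝ) : ℂ) * t)) * B 1 t)
      (fun n => (Measurable.aestronglyMeasurable (by fun_prop)).mul hBm) _
      (ae_of_all _ fun t => ?_)).trans ?_
    · have h1 : Tendsto (fun x : ℝ => Complex.exp (-((x : ℂ) * t)) * B 1 t) (𝓝 0)
          (𝓝 (Complex.exp (-(((0 : ℝ) : ℂ) * t)) * B 1 t)) :=
        Continuous.tendsto (by fun_prop) 0
      rw [Complex.ofReal_zero, zero_mul, neg_zero, Complex.exp_zero, one_mul] at h1
      exact h1.comp tendsto_one_div_add_atTop_nhds_zero_nat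
    · refine liminf_le_of_le (by isBoundedDefault) fun b hb => ?_
      obtain ⟨n, hn⟩ := hb.exists
      refine hn.trans ?_
      have hpos : (0 : ℝ) < 1 / ((n : ℝ) + 1) := by positivity
      rw [eLpNorm_congr_ae (hBh _ hpos)]
      exact hhb _ hpos
  refine ⟨B 1, ⟨hBL, fun s hs => ?_⟩, fun σ hσ => ?_⟩
  · have hs : 0 < s.re := hs
    rw [← hBl (s.re / 2) (by linarith) s (by linarith), laplace, laplace]
    refine integral_congr_ae ?_
    filter_upwards [hBB (s.re / 2) (by linarith)] with t ht
    rw [ht]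
  · rw [IsBromwichIntegral]
    refine (hht σ hσ).congr fun v => eLpNorm_congr_ae ?_
    filter_upwards [hBh σ hσ] with t ht
    rw [mul_sub, ht]

/-! ### Partial fractions, and the absence of poles on the imaginary axis. -/

/-- Finite Taylor expansion of an analytic function with analytic remainder. -/
theorem AnalyticAt.exists_taylor_remainder {z₀ : ℂ} (n : ℕ) {g : ℂ → ℂ} (hg : AnalyticAt ℂ g z₀) :
    ∃ (a : ℕ → ℂ) (h : ℂ → ℂ), a 0 = g z₀ ∧ AnalyticAt ℂ h z₀ ∧
      ∀ z, g z = ∑ k ∈ Finset.range n, a k * (z - z₀) ^ k + (z - z₀) ^ n * h z := by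
  induction n generalizing g with
  | zero => exact ⟨fun _ => g z₀, g, rfl, hg, by simp⟩
  | succ n ih =>
    obtain ⟨P, hP⟩ := hg
    obtain ⟨a, h, -, hh, heq⟩ := ih ⟨_, hP.has_fpower_series_dslope_fslope⟩
    refine ⟨fun k => if k = 0 then g z₀ else a (k - 1), h, by simp, hh, fun z => ?_⟩
    have h1 : g z = g z₀ + (z - z₀) * dslope g z₀ z := by
      have := sub_smul_dslope g z₀ z
      rw [smul_eq_mul] at this
      rw [this]
      ring
    rw [h1, heq, Finset.sum_range_succ', mul_add, Finset.mul_sum]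
    simp only [Nat.add_eq_zero_iff, one_ne_zero, and_false, if_false, Nat.add_sub_cancel, if_true,
      pow_zero, mul_one]
    have h2 : ∀ k ∈ Finset.range n, (z - z₀) * (a k * (z - z₀) ^ k) = a k * (z - z₀) ^ (k + 1) :=
      fun k _ => by ring
    rw [Finset.sum_congr rfl h2]
    ring

/-- The principal part of a meromorphic function at a pole of order `m`. -/
theorem exists_principalPart {G : ℂ → ℂ} {ω : ℂ} (hG : MeromorphicAt G ω) {m : ℕ}
    (hord : meromorphicOrderAt G ω = ((-(m : ℤ) : ℤ) : WithTop ℤ)) :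
    ∃ (a : ℕ → ℂ) (h : ℂ → ℂ), a 0 ≠ 0 ∧ AnalyticAt ℂ h ω ∧ ∀ᶠ z in 𝓝[≠] ω,
      G z = ∑ k ∈ Finset.range m, a k * ((z - ω) ^ (m - k))⁻¹ + h z := by
  -- With `G = (z - ω)^(-m) g`, the `a k` are the Taylor coefficients of `g`. That `a 0 = g(ω)` is
  -- nonzero later makes the polynomial degree exact.
  obtain ⟨g, hg, hg0, hGg⟩ := (meromorphicOrderAt_eq_int_iff hG).1 hord
  obtain ⟨a, h, ha, hh, heq⟩ := hg.exists_taylor_remainder m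
  refine ⟨a, h, ha ▸ hg0, hh, ?_⟩
  filter_upwards [hGg, self_mem_nhdsWithin] with z hz hne
  have hne : z - ω ≠ 0 := sub_ne_zero.2 hne
  rw [hz, heq, zpow_neg, zpow_natCast, smul_eq_mul, mul_add, Finset.mul_sum,
    inv_mul_cancel_left₀ (pow_ne_zero _ hne)]
  congr 1
  refine Finset.sum_congr rfl fun k hk => ?_
  rw [← Nat.sub_add_cancel (Finset.mem_range.1 hk).le, pow_add, Nat.add_sub_cancel]
  field_simp

/-- A meromorphic function on the plane with finitely many poles that vanishes at infinity is the
sum of its principal parts. -/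
theorem exists_partialFractions {G : ℂ → ℂ} (hG : MeromorphicOn G Set.univ)
    (hG0 : Tendsto G (cocompact ℂ) (𝓝 0)) {N : ℕ} {ω : Fin N → ℂ} (hω : Function.Injective ω)
    {m : Fin N → ℕ}
    (hpole : ∀ i, meromorphicOrderAt G (ω i) = ((-(m i : ℤ) : ℤ) : WithTop ℤ))
    (hall : ∀ z, (∀ i, z ≠ ω i) → 0 ≤ meromorphicOrderAt G z) :
    ∃ a : Fin N → ℕ → ℂ, (∀ i, a i 0 ≠ 0) ∧ ∀ z, ∀ᶠ w in 𝓝[≠] z,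
      G w = ∑ i, ∑ k ∈ Finset.range (m i), a i k * ((w - ω i) ^ (m i - k))⁻¹ := by
  choose a h ha hh hGa using fun i => exists_principalPart (hG (ω i) trivial) (hpole i)
  refine ⟨a, ha, ?_⟩
  set S : Fin N → ℂ → ℂ := fun i w =>
    ∑ k ∈ Finset.range (m i), a i k * ((w - ω i) ^ (m i - k))⁻¹ with hS
  have hSan : ∀ i z, z ≠ ω i → AnalyticAt ℂ (S i) z := by
    intro i z hz
    refine Finset.analyticAt_fun_sum _ fun k _ => ?_
    exact analyticAt_const.mul (((analyticAt_id.sub analyticAt_const).pow _).inv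
      (pow_ne_zero _ (sub_ne_zero.2 hz)))
  have hSmer : ∀ i z, MeromorphicAt (S i) z := by
    intro i z
    refine MeromorphicAt.fun_sum fun k _ => ?_
    exact (MeromorphicAt.const _ _).mul
      ((((MeromorphicAt.id z).sub (MeromorphicAt.const _ _)).pow _).inv)
  set W : ℂ → ℂ := fun w => G w - ∑ i, S i w with hW
  have hWmer : MeromorphicOn W Set.univ := fun z _ =>
    (hG z trivial).sub (MeromorphicAt.fun_sum fun i _ => hSmer i z)
  have hWord : ∀ z, 0 ≤ meromorphicOrderAt W z := by
    intro z
    rw [(hWmer z trivial).meromorphicOrderAt_nonneg_iff]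
    by_cases hz : ∃ i, z = ω i
    · obtain ⟨i, rfl⟩ := hz
      refine ⟨fun w => h i w - ∑ j ∈ Finset.univ.erase i, S j w, (hh i).sub
        (Finset.analyticAt_fun_sum _ fun j hj =>
          hSan j _ (hω.ne (Finset.ne_of_mem_erase hj).symm)), ?_⟩
      filter_upwards [hGa i] with w hw
      rw [hW]
      simp only
      rw [hw, ← Finset.add_sum_erase _ _ (Finset.mem_univ i)]
      simp only [hS]
      ring
    · push Not at hz
      obtain ⟨g, hg, hGg⟩ := ((hG z trivial).meromorphicOrderAt_nonneg_iff).1 (hall z hz)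
      refine ⟨fun w => g w - ∑ i, S i w, hg.sub
        (Finset.analyticAt_fun_sum _ fun j _ => hSan j _ (hz j)), ?_⟩
      filter_upwards [hGg] with w hw
      rw [hW]
      simp only [hw]
  -- `W` has only removable singularities, but its values there are arbitrary. Its normal form `E`
  -- is entire and, once shown to vanish at infinity, is zero by Liouville.
  set E := toMeromorphicNFOn W Set.univ with hE
  have hEW : ∀ z, E =ᶠ[𝓝[≠] z] W := fun z => hWmer.toMeromorphicNFOn_eq_self_on_nhdsNE trivial
  have hEan : ∀ z, AnalyticAt ℂ E z := by
    intro z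
    rw [← (meromorphicNFOn_toMeromorphicNFOn W Set.univ
      trivial).meromorphicOrderAt_nonneg_iff_analyticAt,
      meromorphicOrderAt_toMeromorphicNFOn hWmer trivial]
    exact hWord z
  have hS0 : ∀ i, Tendsto (S i) (cocompact ℂ) (𝓝 0) := by
    intro i
    rw [hS, ← Finset.sum_const_zero (s := Finset.range (m i))]
    refine tendsto_finsetSum _ fun k hk => ?_
    have hmk : m i - k ≠ 0 := Nat.sub_ne_zero_of_lt (Finset.mem_range.1 hk)
    have h1 : Tendsto (fun w : ℂ => (w - ω i)⁻¹) (cocompact ℂ) (𝓝 0) := by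
      have h2 : Tendsto (fun w : ℂ => w - ω i) (cocompact ℂ) (cocompact ℂ) :=
        (Homeomorph.subRight (ω i)).isClosedEmbedding.tendsto_cocompact
      rw [Metric.cobounded_eq_cocompact.symm] at h2 ⊢
      exact tendsto_inv₀_cobounded.comp h2
    have h3 := (h1.pow (m i - k)).const_mul (a i k)
    rw [zero_pow hmk, mul_zero] at h3
    simpa [inv_pow] using h3
  have hW0 : Tendsto W (cocompact ℂ) (𝓝 0) := by
    have := hG0.sub (tendsto_finsetSum Finset.univ fun i _ => hS0 i)
    simpa using this
  have hE0 : Tendsto E (cocompact ℂ) (𝓝 0) := by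
    rw [← Metric.cobounded_eq_cocompact] at hW0 ⊢
    rw [tendsto_zero_iff_norm_tendsto_zero] at hW0 ⊢
    rw [Metric.tendsto_nhds] at hW0 ⊢
    intro ε hε
    have h1 := hW0 (ε / 2) (by positivity)
    obtain ⟨R, hR⟩ := (Filter.hasBasis_cobounded_norm (E := ℂ)).eventually_iff.1 h1
    -- `E` and `W` agree only on punctured neighbourhoods, so the bound passes to `E z` by
    -- continuity; `R + 1` keeps a neighbourhood of `z` inside `‖w‖ > R`.
    refine (Filter.hasBasis_cobounded_norm (E := ℂ)).eventually_iff.2 ⟨R + 1, trivial, ?_⟩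
    intro z hz
    have hz : R + 1 ≤ ‖z‖ := hz
    have hopen : ∀ᶠ w in 𝓝 z, R < ‖w‖ :=
      continuous_norm.continuousAt.eventually_const_lt (by linarith)
    have h2 : ∀ᶠ w in 𝓝[≠] z, ‖E w‖ ≤ ε / 2 := by
      filter_upwards [hEW z, hopen.filter_mono nhdsWithin_le_nhds] with w hw hRw
      have := hR.2 hRw.le
      rw [dist_zero_right, norm_norm] at this
      rw [hw]
      exact this.le
    have h3 : ‖E z‖ ≤ ε / 2 :=
      le_of_tendsto ((hEan z).continuousAt.norm.mono_left nhdsWithin_le_nhds) h2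
    rw [dist_zero_right, norm_norm]
    linarith
  have hEz : ∀ z, E z = 0 := fun z =>
    Differentiable.apply_eq_of_tendsto_cocompact (fun z => (hEan z).differentiableAt) z hE0
  intro z
  filter_upwards [hEW z] with w hw
  rw [hEz, hW] at hw
  exact (sub_eq_zero.1 hw.symm)

/-- A meromorphic function that agrees on the right half-plane with a function having uniformly
bounded `L^p` means, `p > 1`, has no poles on the imaginary axis. -/
theorem meromorphicOrderAt_nonneg_of_re_eq_zero {p : ℝ} (hp : 1 < p) {G H : ℂ → ℂ} {z₀ : ℂ}
    (hz₀ : z₀.re = 0) (hG : MeromorphicAt G z₀) (hH : ContinuousOn H rightHalfPlane)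
    (hGH : ∀ z ∈ rightHalfPlane, ∀ᶠ w in 𝓝[≠] z, G w = H w) {M : NNReal}
    (hM : ∀ x : ℝ, 0 < x → eLpNorm (fun y : ℝ => H (x + y * Complex.I)) (ENNReal.ofReal p) ≤ M) :
    0 ≤ meromorphicOrderAt G z₀ := by
  by_contra hneg
  rw [not_le] at hneg
  obtain ⟨n, hn⟩ := WithTop.ne_top_iff_exists.1 hneg.ne_top
  rw [← hn] at hneg
  have hn0 : n < 0 := by exact_mod_cast hneg
  obtain ⟨g, hg, hg0, hGg⟩ := (meromorphicOrderAt_eq_int_iff hG).1 hn.symm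
  set c : ℝ := ‖g z₀‖ / 2 with hc
  have hc0 : 0 < c := half_pos (norm_pos_iff.2 hg0)
  have hgc : ∀ᶠ z in 𝓝 z₀, c < ‖g z‖ :=
    hg.continuousAt.norm.eventually_const_lt (half_lt_self (norm_pos_iff.2 hg0))
  rw [eventually_nhdsWithin_iff] at hGg
  obtain ⟨ρ, hρ, hball⟩ := Metric.eventually_nhds_iff.1
    ((hGg.and hgc).and hg.eventually_analyticAt)
  -- lower bound for `H` near `z₀`
  have hlow : ∀ z ∈ rightHalfPlane, dist z z₀ < min ρ 1 → c / dist z z₀ ≤ ‖H z‖ := by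
    intro z hz hd
    have hne : z ≠ z₀ := by
      rintro rfl
      have : 0 < z.re := hz
      linarith
    have hd0 : 0 < dist z z₀ := dist_pos.2 hne
    obtain ⟨⟨-, h1⟩, h2⟩ := hball (hd.trans_le (min_le_left _ _))
    have hev : ∀ᶠ w in 𝓝[≠] z, H w = (w - z₀) ^ n • g w := by
      have hb : ∀ᶠ w in 𝓝 z, dist w z₀ < ρ :=
        (continuous_id.dist continuous_const).continuousAt.eventually_lt_const
          (hd.trans_le (min_le_left _ _))
      filter_upwards [hGH z hz, hb.filter_mono nhdsWithin_le_nhds,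
        (eventually_ne_nhds hne).filter_mono nhdsWithin_le_nhds] with w hw hwb hwn
      rw [← hw]
      exact (hball hwb).1.1 hwn
    have hHc : ContinuousAt H z := hH.continuousAt
      ((isOpen_lt continuous_const Complex.continuous_re).mem_nhds hz)
    have hgc' : ContinuousAt (fun w => (w - z₀) ^ n • g w) z :=
      ContinuousAt.smul (f := fun w => (w - z₀) ^ n)
        (ContinuousAt.zpow₀ (by fun_prop) n (Or.inl (sub_ne_zero.2 hne))) h2.continuousAt
    have heq : H z = (z - z₀) ^ n • g z :=
      tendsto_nhds_unique (hHc.mono_left nhdsWithin_le_nhds)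
        ((hgc'.mono_left nhdsWithin_le_nhds).congr' (hev.mono fun w hw => hw.symm))
    rw [heq, norm_smul, norm_zpow, ← dist_eq_norm, div_eq_inv_mul]
    refine mul_le_mul ?_ h1.le hc0.le (by positivity)
    rw [← zpow_neg_one]
    exact zpow_le_zpow_right_of_le_one₀ hd0 (hd.le.trans (min_le_right _ _)) (by omega)
  -- On `Re z = x`, a segment of length `2x` lies within `2x` of `z₀`, where `|H| ≥ c/(2x)`. Its
  -- `L^p` norm is thus at least `c (2x)^(1/p - 1)`, unbounded as `x → 0` because `p > 1`.
  have hbd : ∀ x : ℝ, 0 < x → 2 * x < min ρ 1 →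
      ENNReal.ofReal (c * (2 * x) ^ (1 / p - 1)) ≤ M := by
    intro x hx hx2
    refine le_trans ?_ (hM x hx)
    set I := Set.Icc (z₀.im - x) (z₀.im + x) with hI
    have h1 : eLpNorm (I.indicator fun _ : ℝ => (c / (2 * x) : ℝ)) (ENNReal.ofReal p) ≤
        eLpNorm (fun y : ℝ => H (x + y * Complex.I)) (ENNReal.ofReal p) := by
      refine eLpNorm_mono fun y => ?_
      by_cases hy : y ∈ I
      · rw [Set.indicator_of_mem hy, Real.norm_of_nonneg (by positivity)]
        have hzpos : ((x : ℂ) + y * Complex.I) ∈ rightHalfPlane := by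
          simp [rightHalfPlane, hx]
        have hd0 : 0 < dist ((x : ℂ) + y * Complex.I) z₀ := by
          refine dist_pos.2 fun h0 => ?_
          have := congrArg Complex.re h0
          simp [hz₀] at this
          exact hx.ne' this
        have hd : dist ((x : ℂ) + y * Complex.I) z₀ ≤ 2 * x := by
          rw [dist_eq_norm]
          refine le_of_sq_le_sq ?_ (by positivity)
          rw [normSq_line_sub, hz₀]
          have := hy.1
          have := hy.2
          nlinarith
        refine le_trans ?_ (hlow _ hzpos (hd.trans_lt hx2))
        gcongr
      · rw [Set.indicator_of_notMem hy, norm_zero]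
        exact norm_nonneg _
    refine le_trans (le_of_eq ?_) h1
    rw [eLpNorm_indicator_const measurableSet_Icc (by simp; linarith) (by simp),
      Real.volume_Icc, ENNReal.toReal_ofReal (by linarith), ← ofReal_norm,
      Real.norm_of_nonneg (by positivity), show z₀.im + x - (z₀.im - x) = 2 * x by ring,
      ENNReal.ofReal_rpow_of_pos (by positivity), ← ENNReal.ofReal_mul (by positivity),
      Real.rpow_sub_one (by positivity)]
    congr 1
    ring
  have hlt : 1 / p - 1 < 0 := by
    rw [sub_neg, div_lt_one (by linarith)]
    exact hp
  have htop : Tendsto (fun x : ℝ => c * (2 * x) ^ (1 / p - 1)) (𝓝[>] 0) atTop := by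
    refine Tendsto.const_mul_atTop hc0 ((tendsto_rpow_neg_nhdsGT_zero hlt).comp ?_)
    refine tendsto_nhdsWithin_of_tendsto_nhds_of_eventually_within _ ?_ ?_
    · have : Tendsto (fun x : ℝ => 2 * x) (𝓝 0) (𝓝 (2 * 0)) := Continuous.tendsto (by fun_prop) 0
      rw [mul_zero] at this
      exact this.mono_left nhdsWithin_le_nhds
    · filter_upwards [self_mem_nhdsWithin] with x hx
      have : 0 < x := hx
      simpa using this
  have hsmall : ∀ᶠ x : ℝ in 𝓝[>] 0, 2 * x < min ρ 1 := by
    have : ∀ᶠ x : ℝ in 𝓝 0, 2 * x < min ρ 1 :=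
      Continuous.continuousAt (by fun_prop) |>.eventually_lt_const (by simp [hρ])
    exact this.filter_mono nhdsWithin_le_nhds
  obtain ⟨x, ⟨hx1, hx2⟩, hx3⟩ :=
    ((htop.eventually_gt_atTop (M : ℝ)).and hsmall |>.and self_mem_nhdsWithin).exists
  have h4 := hbd x hx3 hx2
  rw [ENNReal.ofReal_le_iff_le_toReal (by simp), ENNReal.coe_toReal] at h4
  linarith

/-! ### Laplace preimages of principal parts. -/

/-- The inverse Laplace transform of a principal part: a polynomial of degree `m - 1` times an
exponential. -/
theorem exists_polynomial_laplace {q : ℝ} (hq : 0 < q) {ω : ℂ} (hω : ω.re < 0) {m : ℕ} (hm : 1 ≤ m)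
    {a : ℕ → ℂ} (ha : a 0 ≠ 0) :
    ∃ P : Polynomial ℂ, P.degree = ((m - 1 : ℕ) : WithBot ℕ) ∧
      MemLp (fun t : ℝ => P.eval (t : ℂ) * Complex.exp (ω * t)) (ENNReal.ofReal q) halfLine ∧
      ∀ s ∈ rightHalfPlane, laplace (fun t : ℝ => P.eval (t : ℂ) * Complex.exp (ω * t)) s =
        ∑ k ∈ Finset.range m, a k * ((s - ω) ^ (m - k))⁻¹ := by
  -- The factorials cancel those in `𝓛(t^j e^{ωt}) = j!/(s - ω)^(j+1)` with `j = m - k - 1`. The top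
  -- coefficient is `a 0 / (m-1)!`.
  set P : Polynomial ℂ := ∑ k ∈ Finset.range m,
    Polynomial.C (a k / (m - k - 1).factorial) * Polynomial.X ^ (m - k - 1) with hP
  have heval : ∀ t : ℝ, P.eval (t : ℂ) * Complex.exp (ω * t) = ∑ k ∈ Finset.range m,
      (a k / (m - k - 1).factorial) * ((t : ℂ) ^ (m - k - 1) * Complex.exp (ω * t)) := by
    intro t
    rw [hP, Polynomial.eval_finsetSum, Finset.sum_mul]
    refine Finset.sum_congr rfl fun k _ => ?_
    simp
    ring
  refine ⟨P, ?_, ?_, fun s hs => ?_⟩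
  · refine Polynomial.degree_eq_of_le_of_coeff_ne_zero ?_ ?_
    · refine (Polynomial.degree_sum_le _ _).trans (Finset.sup_le fun k _ => ?_)
      refine (Polynomial.degree_C_mul_X_pow_le _ _).trans ?_
      exact_mod_cast (by omega : m - k - 1 ≤ m - 1)
    · rw [hP, Polynomial.finsetSum_coeff, Finset.sum_eq_single 0]
      · simp [ha, Nat.factorial_ne_zero]
      · intro k hk hk0
        rw [Polynomial.coeff_C_mul_X_pow, if_neg]
        have := Finset.mem_range.1 hk
        omega
      · intro h0
        exact absurd (Finset.mem_range.2 hm) h0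
  · simp_rw [heval]
    exact memLp_finsetSum _ fun k _ => (memLp_pow_mul_exp hq _ hω).const_mul _
  · have hs : 0 < s.re := hs
    have hint : ∀ k ∈ Finset.range m, Integrable (fun t : ℝ => Complex.exp (-s * t) *
        ((a k / (m - k - 1).factorial) * ((t : ℂ) ^ (m - k - 1) * Complex.exp (ω * t)))) halfLine := by
      intro k _
      refine ((integrable_pow_mul_exp (m - k - 1) (s := ω - s) (by simp; linarith)).const_mul
        (a k / (m - k - 1).factorial)).congr (ae_of_all _ fun t => ?_)
      simp only
      rw [sub_mul, sub_eq_neg_add, Complex.exp_add, neg_mul]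
      ring
    rw [laplace]
    simp_rw [heval, Finset.mul_sum]
    rw [integral_finsetSum _ hint]
    refine Finset.sum_congr rfl fun k hk => ?_
    have h1 := laplace_pow_mul_exp (m - k - 1) (ω := ω) (s := s) (by linarith)
    rw [laplace, Nat.sub_add_cancel (by have := Finset.mem_range.1 hk; omega)] at h1
    simp_rw [mul_left_comm (Complex.exp (-s * _)) (a k / _)]
    rw [integral_const_mul, h1]
    have : ((m - k - 1).factorial : ℂ) ≠ 0 := by exact_mod_cast Nat.factorial_ne_zero _
    field_simp

/-! ### Agreement off isolated points, and the representation theorem. -/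

/-- A property that holds on punctured neighbourhoods of all points of the right half-plane holds
almost everywhere on each vertical line in it. -/
theorem ae_line_of_eventually_nhdsNE {Q : ℂ → Prop}
    (hQ : ∀ z ∈ rightHalfPlane, ∀ᶠ w in 𝓝[≠] z, Q w) {σ : ℝ} (hσ : 0 < σ) :
    ∀ᵐ η : ℝ, Q (σ + η * Complex.I) := by
  have h : {η : ℝ | Q (σ + η * Complex.I)} ∈ codiscreteWithin (Set.univ : Set ℝ) := by
    rw [mem_codiscreteWithin_iff_forall_mem_nhdsNE]
    intro η _
    rw [Set.compl_univ, Set.union_empty]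
    have hmem : (σ : ℂ) + η * Complex.I ∈ rightHalfPlane := by simp [rightHalfPlane, hσ]
    have hc : Tendsto (fun y : ℝ => (σ : ℂ) + y * Complex.I) (𝓝[≠] η)
        (𝓝[≠] ((σ : ℂ) + η * Complex.I)) := by
      refine tendsto_nhdsWithin_of_tendsto_nhds_of_eventually_within _
        ((Continuous.tendsto (by fun_prop) η).mono_left nhdsWithin_le_nhds) ?_
      filter_upwards [self_mem_nhdsWithin] with y hy h0
      refine hy ?_
      have := congrArg Complex.im h0
      simpa using this
    exact hc.eventually (hQ _ hmem)
  have := ae_restrict_le_codiscreteWithin (μ := volume) MeasurableSet.univ h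
  rwa [Measure.restrict_univ] at this

theorem isOpen_rightHalfPlane : IsOpen rightHalfPlane :=
  isOpen_lt continuous_const Complex.continuous_re

/-- Two continuous functions on the right half-plane that agree on punctured neighbourhoods are
equal. -/
theorem eqOn_of_eventually_nhdsNE {u v : ℂ → ℂ} (hu : ContinuousOn u rightHalfPlane)
    (hv : ContinuousOn v rightHalfPlane)
    (h : ∀ z ∈ rightHalfPlane, ∀ᶠ w in 𝓝[≠] z, u w = v w) : Set.EqOn u v rightHalfPlane := by
  intro z hz
  have hn := isOpen_rightHalfPlane.mem_nhds hz
  exact tendsto_nhds_unique ((hu.continuousAt hn).mono_left nhdsWithin_le_nhds)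
    (((hv.continuousAt hn).mono_left nhdsWithin_le_nhds).congr' ((h z hz).mono fun w hw => hw.symm))

theorem MemHardy.congr {q : ℝ} {u v : ℂ → ℂ} (hu : MemHardy q u)
    (h : Set.EqOn v u rightHalfPlane) : MemHardy q v := by
  obtain ⟨hd, M, hM⟩ := hu
  refine ⟨hd.congr h, M, fun x hx => ?_⟩
  have : hardyMean q v x = hardyMean q u x := by
    unfold hardyMean
    have h1 : ∀ y : ℝ, v (x + y * Complex.I) = u (x + y * Complex.I) := fun y =>
      h (show _ ∈ rightHalfPlane by simp [rightHalfPlane, hx])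
    simp_rw [h1]
  rw [this]
  exact hM x hx

theorem isBromwichIntegral_congr {q σ : ℝ} {u v : ℂ → ℂ} {b : ℝ → ℂ}
    (h : ∀ᵐ η : ℝ, u (σ + η * Complex.I) = v (σ + η * Complex.I))
    (hu : IsBromwichIntegral q u σ b) : IsBromwichIntegral q v σ b := by
  have : ∀ w t : ℝ, bromwichTrunc v σ w t = bromwichTrunc u σ w t := by
    intro w t
    unfold bromwichTrunc
    congr 1
    refine intervalIntegral.integral_congr_ae ?_
    filter_upwards [h] with η hη _
    rw [hη]
  unfold IsBromwichIntegral
  simp_rw [this]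
  exact hu

theorem tendsto_cocompact_of_norm_le_div_rpow {G : ℂ → ℂ} {q : ℝ} (hq : 0 < q)
    (h : ∃ C R : ℝ, ∀ s : ℂ, R < ‖s‖ → ‖G s‖ ≤ C / ‖s‖ ^ q) :
    Tendsto G (cocompact ℂ) (𝓝 0) := by
  obtain ⟨C, R, hCR⟩ := h
  have hn := tendsto_norm_cocompact_atTop (E := ℂ)
  have h1 : Tendsto (fun s : ℂ => C / ‖s‖ ^ q) (cocompact ℂ) (𝓝 0) :=
    ((tendsto_rpow_atTop hq).comp hn).const_div_atTop C
  exact squeeze_zero_norm' ((hn.eventually_gt_atTop R).mono hCR) h1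

theorem mainTheorem5
    (p p' : ℝ) (hp1 : 1 < p) (hp2 : p ≤ 2) (hpp' : 1 / p + 1 / p' = 1)
    -- the symbol `f`, analytic in a region `D` containing the right half-plane
    (D : Set ℂ) (hDo : IsOpen D) (hDc : IsConnected D) (hD : rightHalfPlane ⊆ D)
    (f : ℂ → ℂ) (hf : AnalyticOnNhd ℂ f D) (hf0 : ∃ s ∈ D, f s ≠ 0)
    -- the generalized initial condition `r` and the right-hand side `J`
    (r : ℂ → ℂ) (hr : AnalyticOnNhd ℂ r rightHalfPlane)
    (J : ℝ → ℂ) (hJ : MemLp J (ENNReal.ofReal p') halfLine)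
    (hLJ : MemHardy p (laplace J))
    (hJr : QuotientMemHardy p (fun s => laplace J s + r s) f)
    (hJf : QuotientMemHardy p (laplace J) f)
    -- `G` is the meromorphic function `r / f` on the plane, with its decay at infinity
    (G : ℂ → ℂ) (hGmer : MeromorphicOn G Set.univ) (hG : IsQuotient G r f)
    (q : ℝ) (hq : 0 < q)
    (hgrowth : ∃ C R : ℝ, ∀ s : ℂ, R < ‖s‖ → ‖G s‖ ≤ C / ‖s‖ ^ q)
    -- the poles of `r / f` in `Re s < 0` are exactly the `ω i`, of order `m i ≥ 1`
    (N : ℕ) (ω : Fin N → ℂ) (hω : Function.Injective ω) (hωre : ∀ i, (ω i).re < 0)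
    (m : Fin N → ℕ) (hm : ∀ i, 1 ≤ m i)
    (hpole : ∀ i, meromorphicOrderAt G (ω i) = ((-(m i : ℤ) : ℤ) : WithTop ℤ))
    (hall : ∀ s : ℂ, s.re < 0 → meromorphicOrderAt G s < 0 → ∃ i, s = ω i) :
    ∃ φ : ℝ → ℂ,
      -- `φ` is the solution, unique in `L^{p'}(ℝ₊)`
      IsSolution p p' f r J φ ∧
      (∀ ψ : ℝ → ℂ, IsSolution p p' f r J ψ → ψ =ᵐ[halfLine] φ) ∧
      -- `φ = 𝓛⁻¹((𝓛(J) + r) / f)`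
      (∃ Φ : ℂ → ℂ, MemHardy p Φ ∧ IsQuotient Φ (fun s => laplace J s + r s) f ∧
        IsInverseLaplace p' Φ φ) ∧
      -- the representation formula, with one Bromwich integral `b` for all `σ > 0`
      ∃ (P : Fin N → Polynomial ℂ) (b : ℝ → ℂ),
        (∀ i, (P i).degree = ((m i - 1 : ℕ) : WithBot ℕ)) ∧
        MemLp b (ENNReal.ofReal p') halfLine ∧
        (∀ σ : ℝ, 0 < σ → IsBromwichIntegral p' (fun s => laplace J s / f s) σ b) ∧
        ∀ᵐ t ∂halfLine,
          φ t = b t + ∑ i, (P i).eval (t : ℂ) * Complex.exp (ω i * (t : ℂ)) := by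
  have hpp : p.HolderConjugate p' := by
    rw [Real.holderConjugate_iff]
    exact ⟨hp1, by simpa using hpp'⟩
  have hp0 : 0 < p := hpp.pos
  have hp0' : 0 < p' := hpp.symm.pos
  obtain ⟨Φ, hΦ, hΦq⟩ := hJr
  obtain ⟨F, hF, hFq⟩ := hJf
  -- Identity theorem on the connected set `D`: the zeros of `f` are isolated, so every quotient
  -- identity holds on punctured neighbourhoods.
  have hfne : ∀ z ∈ rightHalfPlane, ∀ᶠ w in 𝓝[≠] z, f w ≠ 0 := by
    intro z hz
    refine (hf z (hD hz)).eventually_eq_zero_or_eventually_ne_zero.resolve_left fun h0 => ?_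
    obtain ⟨s, hs, hfs⟩ := hf0
    exact hfs (hf.eqOn_zero_of_preconnected_of_eventuallyEq_zero hDc.isPreconnected (hD hz) h0 hs)
  have hmemne : ∀ z ∈ rightHalfPlane, ∀ᶠ w in 𝓝[≠] z, w ∈ rightHalfPlane ∧ f w ≠ 0 :=
    fun z hz => ((isOpen_rightHalfPlane.eventually_mem hz).filter_mono nhdsWithin_le_nhds).and
      (hfne z hz)
  -- `r / f` is the difference `H` of two functions in the Hardy space
  set H : ℂ → ℂ := fun z => Φ z - F z with hHdef
  have hHd : DifferentiableOn ℂ H rightHalfPlane := hΦ.1.fun_sub hF.1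
  have hGH : ∀ z ∈ rightHalfPlane, ∀ᶠ w in 𝓝[≠] z, G w = H w := by
    intro z hz
    filter_upwards [hmemne z hz] with w ⟨hw, hfw⟩
    rw [hHdef]
    simp only
    rw [hG w hw hfw, hΦq w hw hfw, hFq w hw hfw]
    ring
  obtain ⟨M₁, hM₁⟩ := hΦ.exists_eLpNorm_le hp0
  obtain ⟨M₂, hM₂⟩ := hF.exists_eLpNorm_le hp0
  have hHM : ∀ x : ℝ, 0 < x →
      eLpNorm (fun y : ℝ => H (x + y * Complex.I)) (ENNReal.ofReal p) ≤ (M₁ + M₂ : NNReal) := by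
    intro x hx
    rw [ENNReal.coe_add]
    exact (eLpNorm_sub_le (continuous_line hΦ.1.continuousOn hx).aestronglyMeasurable
      (continuous_line hF.1.continuousOn hx).aestronglyMeasurable
      (by rw [← ENNReal.ofReal_one]; exact ENNReal.ofReal_le_ofReal hp1.le)).trans
      (add_le_add (hM₁ x hx) (hM₂ x hx))
  have hord : ∀ z, (∀ i, z ≠ ω i) → 0 ≤ meromorphicOrderAt G z := by
    intro z hz
    rcases lt_trichotomy z.re 0 with h | h | h
    · by_contra hneg
      obtain ⟨i, hi⟩ := hall z h (not_le.1 hneg)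
      exact hz i hi
    · exact meromorphicOrderAt_nonneg_of_re_eq_zero hp1 h (hGmer z trivial) hHd.continuousOn hGH hHM
    · rw [(hGmer z trivial).meromorphicOrderAt_nonneg_iff]
      exact ⟨H, hHd.analyticAt (isOpen_rightHalfPlane.mem_nhds h), hGH z h⟩
  obtain ⟨a, ha0, ha⟩ := exists_partialFractions hGmer
    (tendsto_cocompact_of_norm_le_div_rpow hq hgrowth) hω hpole hord
  have hHS : Set.EqOn H (fun w => ∑ i, ∑ k ∈ Finset.range (m i),
      a i k * ((w - ω i) ^ (m i - k))⁻¹) rightHalfPlane := by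
    refine eqOn_of_eventually_nhdsNE hHd.continuousOn ?_ fun z hz => ?_
    · refine continuousOn_finsetSum _ fun i _ => continuousOn_finsetSum _ fun k _ => ?_
      refine continuousOn_const.mul (ContinuousOn.inv₀ (by fun_prop) fun w hw => ?_)
      refine pow_ne_zero _ (sub_ne_zero.2 fun h0 => ?_)
      have h1 : 0 < w.re := hw
      rw [h0] at h1
      exact (hωre i).not_gt h1
    · filter_upwards [hGH z hz, ha z] with w h1 h2
      rw [← h1, h2]
  choose P hPdeg hPL hPlap using fun i =>
    exists_polynomial_laplace hp0' (hωre i) (hm i) (ha0 i)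
  obtain ⟨b, ⟨hbL, hblap⟩, hbB⟩ := hF.exists_isInverseLaplace hp2 hpp
  set φ : ℝ → ℂ := fun t => b t + ∑ i, (P i).eval (t : ℂ) * Complex.exp (ω i * (t : ℂ)) with hφ
  have hφL : MemLp φ (ENNReal.ofReal p') halfLine :=
    hbL.add (memLp_finsetSum _ fun i _ => hPL i)
  have hφlap : ∀ s ∈ rightHalfPlane, laplace φ s = Φ s := by
    intro s hs
    have hi1 := integrable_exp_mul hpp hbL hs
    have hi2 : ∀ i ∈ Finset.univ, Integrable (fun t : ℝ => Complex.exp (-s * t) *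
        ((P i).eval (t : ℂ) * Complex.exp (ω i * t))) halfLine := fun i _ =>
      integrable_exp_mul hpp (hPL i) hs
    have h1 := hHS hs
    simp only [hHdef] at h1
    rw [sub_eq_iff_eq_add] at h1
    rw [h1, ← hblap s hs, laplace]
    simp_rw [hφ, mul_add, Finset.mul_sum]
    rw [integral_add hi1 (integrable_finsetSum _ hi2), integral_finsetSum _ hi2, add_comm]
    congr 1
    exact Finset.sum_congr rfl fun i _ => hPlap i s hs
  have hfc : ContinuousOn f rightHalfPlane := fun z hz =>
    (hf z (hD hz)).continuousAt.continuousWithinAt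
  have hsol : Set.EqOn (fun s => f s * laplace φ s - r s) (laplace J) rightHalfPlane := by
    -- Immediate where `f ≠ 0`; continuity of both sides extends it across the zeros of `f`.
    have h1 : Set.EqOn (fun s => f s * Φ s - r s) (laplace J) rightHalfPlane := by
      refine eqOn_of_eventually_nhdsNE ((hfc.mul hΦ.1.continuousOn).sub hr.continuousOn)
        hLJ.1.continuousOn fun z hz => ?_
      filter_upwards [hmemne z hz] with w ⟨hw, hfw⟩
      rw [hΦq w hw hfw]
      field_simp
      ring
    intro s hs
    simp only
    rw [hφlap s hs]
    exact h1 hs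
  refine ⟨φ, ⟨hφL, hLJ.congr hsol, hJ, fun s hs => (hsol hs).symm⟩, ?_,
    ⟨Φ, hΦ, hΦq, hφL, hφlap⟩, P, b, hPdeg, hbL, ?_, ae_of_all _ fun t => rfl⟩
  · rintro ψ ⟨hψL, -, -, hψ⟩
    have hone : (0 : ℝ) < ((1 : ℝ) : ℂ).re := by simp
    refine ae_eq_of_laplace_ae_eq (c := 1) (integrable_exp_mul hpp hψL hone)
      (integrable_exp_mul hpp hφL hone) ?_
    refine ae_line_of_eventually_nhdsNE (Q := fun w => laplace ψ w = laplace φ w)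
      (fun z hz => ?_) one_pos
    filter_upwards [hmemne z hz] with w ⟨hw, hfw⟩
    have h1 := hψ w hw
    have h2 := hsol hw
    simp only at h1 h2
    rw [← h2] at h1
    exact mul_left_cancel₀ hfw (sub_left_inj.1 h1.symm)
  · intro σ hσ
    -- At a zero of `f` the literal quotient takes the value `0` instead of `F`; this affects only a
    -- null set of each vertical line.
    refine isBromwichIntegral_congr ?_ (hbB σ hσ)
    refine ae_line_of_eventually_nhdsNE (Q := fun w => F w = laplace J w / f w)
      (fun z hz => ?_) hσ
    filter_upwards [hmemne z hz] with w ⟨hw, hfw⟩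
    exact hFq w hw hfw
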